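/- Let $d\ge 1$, $r\ge 2$ and $N=(d+1)(r-1)$. Fix vectors $w_1,\dots,w_r\in\mathbb R^{r-1}$ that form the vertex set of a regular $(r-1)$-simplex centered at the origin. For $x\in\mathbb R^d$ put $\varphi_i(x)=(x,1)\otimes w_i\in\mathbb R^N$, where $(u\otimes v)=(u_1v_1,u_1v_2,\dots,u_2v_1,\dots)$. For an $r$-tuple $P=(P_1,\dots,P_r)$ of finite sets in $\mathbb R^d$ put $\Phi(P)=\bigcup_i\varphi_i(P_i)$, and let $P-a=(P_1\setminus\{a\},\dots,P_r\setminus\{a\})$. A BMZ-collection is a tuple $\mathcal C=(C_1,\dots,C_{d+2})$ of pairwise disjoint sets in $\mathbb R^d$ with $|C_1|=\dots=|C_{d+1}|=r-1$ and $C_{d+2}=\{z\}$. The points of its ground set $C=\bigcup_k C_k$ are numbered $c_1,\dots,c_{N+1}=z$ so that $C_1$ consists of the first $r-1$ points, $C_2$ of the next $r-1$ points, and so on. Let $\mathbf R(\mathcal C)$ be the set of all $r$-tuples $R=(R_1,\dots,R_r)$ of pairwise disjoint (possibly empty) sets with $\bigcup_i R_i=C$, $|R_i\cap C_k|\le 1$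 for all $i,k$, and $z\in R_r$. For $R\in\mathbf R(\mathcal C)$ let $F_R=\operatorname{conv}\Phi(R-z)$. The collection $\mathcal C$ is in sufficiently general position if for every $R\in\mathbf R(\mathcal C)$ the set $\Phi(R-z)$ is affinely independent (so that $F_R$ is an $(N-1)$-dimensional simplex) and $0\notin\operatorname{aff}\Phi(R-a)$ for every $a\in C$. For $R\in\mathbf R(\mathcal C)$ let $\operatorname{gsgn}(R)$ be the sign of the determinant of the $N\times N$ matrix whose $j$th row is $\varphi_i(c_j)$, where $c_j\in R_i$. For $1\le k\le d+1$ let $\pi_k$ be the permutation of $\{1,\dots,r\}$ such that, for $j\le r-1$, $R_{\pi_k(j)}$ contains the $j$th point of $C_k$, and $\pi_k(r)$ is the index of the only class containing no point of $C_k$. Put $\operatorname{csgn}(R)=\prod_{k=1}^{d+1}\operatorname{sgn}\pi_k$ and $\operatorname{sgn}(R)=\operatorname{gsgn}(R)\operatorname{csgn}(R)$. Let $\rho=\{-t\,\varphi_r(z):t\ge 0\}$. The degree of $\mathcal C$ is $$\deg(\mathcal C)=\sum_{R\in\mathbf R(\mathcal C):\ \rho\cap F_R\ne\emptyset}\operatorname{sgn}(R)$$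 (for $\mathcal C$ in sufficiently general position, the condition $\rho\cap F_R\neq\emptyset$ says exactly that $R$ is Tverberg, i.e. $\bigcap_i\operatorname{conv}(R_i)\ne\emptyset$). If $\mathcal C$ and $\mathcal C'$ are two BMZ-collections for the same $d$ and $r$, both in sufficiently general position, then $$\deg(\mathcal C)\equiv\deg(\mathcal C')\pmod{r!}.$$ -/

import Mathlib

open scoped Nat

/-- A BMZ-collection in `ℝ^d` for `r = n + 1`: the color classes `C_1, …, C_{d+1}` have
`n = r - 1` points each, the class `C_{d+2} = {z}` is a singleton, and the classes are pairwise
disjoint. The points are numbered: `c k j` is the `j`-th point of the `k`-th class, so in the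
numbering of the whole ground set the points of the first class come first, then those of the
second class, and so on, and `z` is the last point. -/
structure BMZCollection (d n : ℕ) where
  c : Fin (d + 1) → Fin n → (Fin d → ℝ)
  z : Fin d → ℝ
  c_injective : Function.Injective fun p : Fin (d + 1) × Fin n => c p.1 p.2
  c_ne_z : ∀ k j, c k j ≠ z

noncomputable section

namespace BMZ

/-- `x⁺ = (x, 1)`. -/
def plus {d : ℕ} (x : Fin d → ℝ) : Fin (d + 1) → ℝ := Fin.snoc x 1

/-- `w_1, …, w_r` (with `r = n + 1`) are the vertices of a regular simplex of dimension
`n = r - 1` in `ℝ^{r-1}` whose center is the origin. -/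
structure IsCenteredRegular {n : ℕ} (w : Affine.Simplex ℝ (EuclideanSpace ℝ (Fin n)) n) :
    Prop where
  regular : w.Regular
  center : ∑ i, w.points i = 0

/-- The `i`-th clone `φ_i(x) = x⁺ ⊗ w_i` of `x`. The space `ℝ^N`, `N = (d + 1)(r - 1)`, has its
coordinates indexed by the pairs in `Fin (d + 1) × Fin n`. -/
def clone {d n : ℕ} (w : Affine.Simplex ℝ (EuclideanSpace ℝ (Fin n)) n) (i : Fin (n + 1))
    (x : Fin d → ℝ) : Fin (d + 1) × Fin n → ℝ :=
  fun p => plus x p.1 * w.points i p.2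

/-- The Sarkaria–Onn transform `Φ(P) = ⋃ i, {φ_i(p) : p ∈ P_i}`. -/
def transform {d n : ℕ} (w : Affine.Simplex ℝ (EuclideanSpace ℝ (Fin n)) n)
    (P : Fin (n + 1) → Finset (Fin d → ℝ)) : Set (Fin (d + 1) × Fin n → ℝ) :=
  ⋃ i, clone w i '' (P i : Set (Fin d → ℝ))

/-- `R - a`: the point `a` is removed from the class that contains it. -/
def remove {d n : ℕ} (R : Fin (n + 1) → Finset (Fin d → ℝ)) (a : Fin d → ℝ) :
    Fin (n + 1) → Finset (Fin d → ℝ) :=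
  fun i => (R i).erase a

end BMZ

namespace BMZCollection

open BMZ

variable {d n : ℕ} (C : BMZCollection d n)

/-- The color classes `C_1, …, C_{d+2}`. -/
def color : Fin (d + 2) → Finset (Fin d → ℝ) :=
  Fin.snoc (α := fun _ => Finset (Fin d → ℝ)) (fun k => Finset.univ.image (C.c k)) {C.z}

/-- The ground set `C_1 ∪ ⋯ ∪ C_{d+2}`. -/
def ground : Finset (Fin d → ℝ) := Finset.univ.biUnion C.color

/-- `R = (R_1, …, R_r)` is a maximal rainbow `r`-partition: the classes are pairwise disjoint,
they are rainbow (at most one point of each color), and they cover exactly the ground set.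
Classes may be empty. -/
structure IsMaximalRainbow (R : Fin (n + 1) → Finset (Fin d → ℝ)) : Prop where
  disjoint : ∀ i i', i ≠ i' → Disjoint (R i) (R i')
  rainbow : ∀ i k, (R i ∩ C.color k).card ≤ 1
  cover : Finset.univ.biUnion R = C.ground

open Classical in
/-- The collection of all maximal rainbow `r`-partitions having `z` in the last class. -/
def partitions : Finset (Fin (n + 1) → Finset (Fin d → ℝ)) :=
  (Fintype.piFinset fun _ => C.ground.powerset).filter fun R =>
    C.IsMaximalRainbow R ∧ C.z ∈ R (Fin.last n)

theorem mem_partitions {R : Fin (n + 1) → Finset (Fin d → ℝ)} :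
    R ∈ C.partitions ↔ C.IsMaximalRainbow R ∧ C.z ∈ R (Fin.last n) := by
  simp only [partitions, Finset.mem_filter, Fintype.mem_piFinset, Finset.mem_powerset,
    and_iff_right_iff_imp]
  rintro ⟨h, -⟩ i
  rw [← h.cover]
  exact Finset.subset_biUnion_of_mem R (Finset.mem_univ i)

theorem c_mem_color (k : Fin (d + 1)) (j : Fin n) : C.c k j ∈ C.color k.castSucc := by
  simp [color]

theorem c_mem_ground (k : Fin (d + 1)) (j : Fin n) : C.c k j ∈ C.ground :=
  Finset.mem_biUnion.2 ⟨_, Finset.mem_univ _, C.c_mem_color k j⟩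

/-- `F_R = conv Φ(R - z)`. -/
def face (w : Affine.Simplex ℝ (EuclideanSpace ℝ (Fin n)) n)
    (R : Fin (n + 1) → Finset (Fin d → ℝ)) : Set (Fin (d + 1) × Fin n → ℝ) :=
  convexHull ℝ (transform w (remove R C.z))

/-- Sufficiently general position: every `F_R` is an `(N-1)`-dimensional simplex, i.e. its
vertices are affinely independent, and the affine span of every `Φ(R - a)` avoids the origin. -/
structure SufficientlyGeneral (w : Affine.Simplex ℝ (EuclideanSpace ℝ (Fin n)) n) : Prop where
  affineIndependent : ∀ R ∈ C.partitions,
    AffineIndependent ℝ ((↑) : transform w (remove R C.z) → (Fin (d + 1) × Fin n → ℝ))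
  zero_notMem : ∀ R ∈ C.partitions, ∀ a ∈ C.ground,
    (0 : Fin (d + 1) × Fin n → ℝ) ∉ affineSpan ℝ (transform w (remove R a))

open Classical in
/-- The index `i` of the class `R_i` that contains the point `x`. -/
def classIndex (R : Fin (n + 1) → Finset (Fin d → ℝ)) (x : Fin d → ℝ) : Fin (n + 1) :=
  if h : ∃ i, x ∈ R i then h.choose else Fin.last n

theorem mem_iff_classIndex {R : Fin (n + 1) → Finset (Fin d → ℝ)} (hR : C.IsMaximalRainbow R)
    {x : Fin d → ℝ} (hx : x ∈ C.ground) (i : Fin (n + 1)) :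
    x ∈ R i ↔ classIndex R x = i := by
  have h : ∃ i, x ∈ R i := by
    rw [← hR.cover] at hx
    simpa using hx
  have hm : x ∈ R (classIndex R x) := by
    rw [classIndex, dif_pos h]
    exact h.choose_spec
  constructor
  · intro hi
    by_contra hne
    exact Finset.disjoint_left.1 (hR.disjoint _ _ hne) hm hi
  · rintro rfl
    exact hm

/-- The square matrix whose row `(k, j)` consists of the coordinates of the vertex of `F_R`
that is a clone of the point `c k j`. Rows and columns are indexed by the same type; rows are in
the order of the numbering of the points, and columns are in the order of the coordinates of a
tensor product, both lexicographic. -/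
def vertexMatrix (w : Affine.Simplex ℝ (EuclideanSpace ℝ (Fin n)) n)
    (R : Fin (n + 1) → Finset (Fin d → ℝ)) :
    Matrix (Fin (d + 1) × Fin n) (Fin (d + 1) × Fin n) ℝ :=
  Matrix.of fun p => clone w (classIndex R (C.c p.1 p.2)) (C.c p.1 p.2)

/-- The geometric sign. -/
def gsgn (w : Affine.Simplex ℝ (EuclideanSpace ℝ (Fin n)) n)
    (R : Fin (n + 1) → Finset (Fin d → ℝ)) : ℤ :=
  (SignType.sign (C.vertexMatrix w R).det : ℤ)

open Classical in
/-- The permutation `π_k` of the rows given by the rooks on the `k`-th chessboard: for `j ≤ r - 1`,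
`π_k(j)` is the index of the class containing the `j`-th point of color `k`, and hence `π_k(r)` is
the index of the only class that contains no point of color `k`. -/
def rookPerm (R : Fin (n + 1) → Finset (Fin d → ℝ)) (k : Fin (d + 1)) :
    Equiv.Perm (Fin (n + 1)) :=
  if h : ∃ π : Equiv.Perm (Fin (n + 1)), ∀ j : Fin n, C.c k j ∈ R (π j.castSucc) then h.choose
  else 1

/-- The permutation describing the rooks on a chessboard exists and is unique. -/
theorem existsUnique_rookPerm {R : Fin (n + 1) → Finset (Fin d → ℝ)}
    (hR : C.IsMaximalRainbow R) (k : Fin (d + 1)) :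
    ∃! π : Equiv.Perm (Fin (n + 1)), ∀ j : Fin n, C.c k j ∈ R (π j.castSucc) := by
  have key : ∀ j i, C.c k j ∈ R i ↔ classIndex R (C.c k j) = i := fun j i =>
    C.mem_iff_classIndex hR (C.c_mem_ground k j) i
  have hinj : Function.Injective fun j => classIndex R (C.c k j) := by
    intro j j' hjj
    have h1 := (key j _).2 rfl
    have h2 := (key j' _).2 hjj.symm
    have h3 := Finset.card_le_one.1 (hR.rainbow (classIndex R (C.c k j)) k.castSucc)
      _ (Finset.mem_inter.2 ⟨h1, C.c_mem_color k j⟩)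
      _ (Finset.mem_inter.2 ⟨h2, C.c_mem_color k j'⟩)
    have h4 := @C.c_injective (k, j) (k, j') h3
    exact congrArg Prod.snd h4
  have hns : ¬ Function.Surjective fun j => classIndex R (C.c k j) := by
    intro hs
    have := Fintype.card_le_of_surjective _ hs
    simp at this
  obtain ⟨m, hm⟩ := not_forall.1 hns
  have hm' : ∀ j, classIndex R (C.c k j) ≠ m := fun j h => hm ⟨j, h⟩
  have hg : Function.Injective
      (Fin.snoc (α := fun _ => Fin (n + 1)) (fun j => classIndex R (C.c k j)) m) := by
    intro a b
    refine Fin.lastCases ?_ (fun a => ?_) a <;> refine Fin.lastCases ?_ (fun b => ?_) b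
    · simp
    · intro h
      simp only [Fin.snoc_last, Fin.snoc_castSucc] at h
      exact absurd h.symm (hm' b)
    · intro h
      simp only [Fin.snoc_last, Fin.snoc_castSucc] at h
      exact absurd h (hm' a)
    · intro h
      simp only [Fin.snoc_castSucc] at h
      rw [hinj h]
  refine ⟨Equiv.ofBijective _ (Finite.injective_iff_bijective.1 hg), fun j => ?_, fun π hπ => ?_⟩
  · rw [key, Equiv.ofBijective_apply, Fin.snoc_castSucc]
  · have hπ' : ∀ j : Fin n, π j.castSucc = classIndex R (C.c k j) := fun j =>
      ((key j _).1 (hπ j)).symm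
    ext1 a
    refine Fin.lastCases ?_ (fun j => ?_) a
    · rw [Equiv.ofBijective_apply, Fin.snoc_last]
      obtain ⟨b, hb⟩ := π.surjective m
      revert hb
      refine Fin.lastCases (fun h => h) (fun j h => ?_) b
      exact absurd ((hπ' j).symm.trans h) (hm' j)
    · rw [Equiv.ofBijective_apply, Fin.snoc_castSucc, hπ']

theorem c_mem_rookPerm {R : Fin (n + 1) → Finset (Fin d → ℝ)} (hR : C.IsMaximalRainbow R)
    (k : Fin (d + 1)) (j : Fin n) : C.c k j ∈ R (C.rookPerm R k j.castSucc) := by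
  have h := (C.existsUnique_rookPerm hR k).exists
  rw [rookPerm, dif_pos h]
  exact h.choose_spec j

/-- The combinatorial sign. -/
def csgn (R : Fin (n + 1) → Finset (Fin d → ℝ)) : ℤ :=
  ∏ k, (Equiv.Perm.sign (C.rookPerm R k) : ℤ)

/-- The sign of `F_R`. -/
def sgn (w : Affine.Simplex ℝ (EuclideanSpace ℝ (Fin n)) n)
    (R : Fin (n + 1) → Finset (Fin d → ℝ)) : ℤ :=
  C.gsgn w R * C.csgn R

/-- The ray `ρ` emanating from the origin in the direction opposite to `z* = φ_r(z)`. -/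
def ray (w : Affine.Simplex ℝ (EuclideanSpace ℝ (Fin n)) n) :
    Set (Fin (d + 1) × Fin n → ℝ) :=
  {y | ∃ t : ℝ, 0 ≤ t ∧ y = -(t • clone w (Fin.last n) C.z)}

open Classical in
/-- The degree: the sum of the signs of all `F_R` that meet the ray `ρ`. -/
def degree (w : Affine.Simplex ℝ (EuclideanSpace ℝ (Fin n)) n) : ℤ :=
  ∑ R ∈ C.partitions with (C.ray w ∩ C.face w R).Nonempty, C.sgn w R

end BMZCollection

end

/-! The partitions in `C.partitions` correspond to tuples π of d + 1 permutations of the r classes,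
i.e. to rook placements on d + 1 chessboards. So the degree is the sum over π of `rookSign π` times
the `index` of (φ_r(z), V_π), where the rows of V_π are the clones of the coloured points and
`index` counts, with sign, whether the simplex on φ_r(z) and these rows contains the origin
(`BMZCollection.degree_eq_rookDegree`). This sum makes sense for arbitrary points, and the points of
one collection can be carried to those of the other one at a time.

A single move rests on the vanishing winding number of the boundary of an (N+1)-simplex: index p V =
index q V + Σ_m index p (V with row m replaced by q) (`index_eq_index_add_sum`). Once row m is
replaced, the place of the rook in column m matters only through q. Sliding that rook to the free
row of its board reverses `rookSign`, so after summation over π these terms cancel whenever q does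
not feel the slide. If z moves to z', then q = φ_r(z') for all π, everything cancels, and the degree
is unchanged. If the m-th point moves to y, then q is the clone of y in the class π assigns to
column m, and the term for m survives: it is the degree of the new configuration. The error Σ_π ±
index(q, V_π) no longer singles out the last class. The symmetric group on the classes therefore
preserves every summand (`rookSign_mul_index_eq`): a permutation σ acts by a linear map of
determinant sgn(σ)^(d+1), the same factor by which the product of the d + 1 combinatorial signs
changes. This action on tuples is free, so the error is divisible by r!.

It remains to make the moves generic. The degree is locally constant at a sufficiently general
collection, and joint general position of all 2(N+1) points is dense (`dense_inGeneralPosition`), so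
both collections can be perturbed at once. More than d + 1 clones from one class are always linearly
dependent; hence general position can only exclude short nonnegative relations, and a Carathéodory
reduction brings these back to generic nonvanishing of determinants. -/

namespace BMZ

/-! ### Nonnegative relations among N + 2 vectors in dimension N. -/

section PositiveRelations

variable {κ E : Type*} [Fintype κ] [AddCommGroup E] [Module ℝ E]

/-- The vectors `u k` satisfy a nontrivial linear relation with nonnegative coefficients. -/
def PosDependent (u : κ → E) : Prop :=
  ∃ c : κ → ℝ, 0 ≤ c ∧ c ≠ 0 ∧ Fintype.linearCombination ℝ u c = 0

/-- The vectors `u k`, `k ≠ a`, satisfy a nontrivial linear relation with nonnegative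
coefficients. -/
def PosDependentOff (u : κ → E) (a : κ) : Prop :=
  ∃ c : κ → ℝ, 0 ≤ c ∧ c ≠ 0 ∧ Fintype.linearCombination ℝ u c = 0 ∧ c a = 0

/-- A nonnegative linear relation with two vanishing coefficients is trivial. -/
def RidgeFree (u : κ → E) : Prop :=
  ∀ a b, a ≠ b → ∀ c : κ → ℝ, 0 ≤ c → Fintype.linearCombination ℝ u c = 0 →
    c a = 0 → c b = 0 → c = 0

/-- The ratio test: s is the smallest ratio c k / b k over the indices with b k > 0. -/
theorem exists_sub_smul_nonneg {c b : κ → ℝ} (hc : 0 ≤ c) (hbc : ∀ k, c k = 0 → b k ≤ 0)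
    (hb : ∃ k, 0 < b k) :
    ∃ s : ℝ, 0 < s ∧ 0 ≤ c - s • b ∧ ∃ k, c k ≠ 0 ∧ c k - s * b k = 0 := by
  classical
  obtain ⟨k₀, hk₀⟩ := hb
  obtain ⟨k, hk, hmin⟩ := Finset.exists_min_image (Finset.univ.filter fun k => 0 < b k)
    (fun k => c k / b k) ⟨k₀, by simpa using hk₀⟩
  have hbk : 0 < b k := by simpa using hk
  have hck : c k ≠ 0 := fun h => (hbc k h).not_gt hbk
  have hckp : 0 < c k := lt_of_le_of_ne (hc k) hck.symm
  refine ⟨c k / b k, div_pos hckp hbk, fun l => ?_, k, hck, ?_⟩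
  · simp only [Pi.zero_apply, Pi.sub_apply, Pi.smul_apply, smul_eq_mul, sub_nonneg]
    rcases lt_or_ge 0 (b l) with hl | hl
    · have := hmin l (by simpa using hl)
      rwa [le_div_iff₀ hl] at this
    · exact (mul_nonpos_of_nonneg_of_nonpos (div_pos hckp hbk).le hl).trans (hc l)
  · field_simp
    ring

theorem RidgeFree.pos {u : κ → E} (hu : RidgeFree u) {a : κ} {c : κ → ℝ} (hc : 0 ≤ c)
    (hc0 : c ≠ 0) (huc : Fintype.linearCombination ℝ u c = 0) (ha : c a = 0) {b : κ}
    (hb : b ≠ a) : 0 < c b :=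
  lt_of_le_of_ne (hc b) fun h => hc0 (hu a b hb.symm c hc huc ha h.symm)

/-- Otherwise, subtracting from c the largest multiple of b (or of -b) that keeps it nonnegative
would produce a nontrivial nonnegative relation with a second zero. -/
theorem RidgeFree.exists_smul_eq {u : κ → E} (hu : RidgeFree u) {a : κ} {c b : κ → ℝ}
    (hc : 0 ≤ c) (hc0 : c ≠ 0) (huc : Fintype.linearCombination ℝ u c = 0) (ha : c a = 0)
    (hub : Fintype.linearCombination ℝ u b = 0) (hba : b a = 0) : ∃ t : ℝ, b = t • c := by
  have key : ∀ b : κ → ℝ, Fintype.linearCombination ℝ u b = 0 → b a = 0 → (∃ k, 0 < b k) →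
      ∃ t : ℝ, b = t • c := by
    intro b hub hba hb
    obtain ⟨s, hs, hnn, k, hk, hk0⟩ := exists_sub_smul_nonneg hc (fun k hk => by
      by_cases hka : k = a
      · rw [hka, hba]
      · exact absurd hk (hu.pos hc hc0 huc ha hka).ne') hb
    have hka : a ≠ k := fun h => hk (h ▸ ha)
    have := hu a k hka (c - s • b) hnn (by simp [map_sub, map_smul, huc, hub])
      (by simp [ha, hba]) (by simpa using hk0)
    refine ⟨s⁻¹, ?_⟩
    rw [sub_eq_zero.1 this, smul_smul, inv_mul_cancel₀ hs.ne', one_smul]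
  by_cases hb : ∃ k, 0 < b k
  · exact key b hub hba hb
  by_cases hb' : ∃ k, 0 < (-b) k
  · obtain ⟨t, ht⟩ := key (-b) (by simp [map_neg, hub]) (by simp [hba]) hb'
    exact ⟨-t, by rw [neg_smul, ← ht, neg_neg]⟩
  · refine ⟨0, ?_⟩
    push Not at hb hb'
    ext k
    have h1 := hb k
    have h2 := hb' k
    simp only [Pi.neg_apply, Left.neg_nonpos_iff] at h2
    simp [le_antisymm h1 h2]

/-- Under these hypotheses the relations form a plane, and the nonnegative ones form a cone in it
with exactly two boundary rays. Each ray has a single vanishing coefficient; one ray vanishes at a,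
the other at b. -/
theorem RidgeFree.existsUnique_ne [FiniteDimensional ℝ E] {u : κ → E} (hu : RidgeFree u)
    (hcard : Fintype.card κ = Module.finrank ℝ E + 2) {a : κ} (h : PosDependentOff u a) :
    ∃! b, b ≠ a ∧ PosDependentOff u b := by
  classical
  obtain ⟨c, hc, hc0, huc, ha⟩ := h
  have hpos : ∀ b, b ≠ a → 0 < c b := fun b => hu.pos hc hc0 huc ha
  -- The kernel has dimension at least 2, while the relations vanishing at a form only the line
  -- through c.
  have hexists : ∃ μ : κ → ℝ, Fintype.linearCombination ℝ u μ = 0 ∧ 0 < μ a := by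
    by_contra! hcon
    have hzero : ∀ μ : κ → ℝ, Fintype.linearCombination ℝ u μ = 0 → μ a = 0 := by
      intro μ hμ
      have h1 := hcon μ hμ
      have h2 := hcon (-μ) (by simp [map_neg, hμ])
      simp only [Pi.neg_apply, Left.neg_nonpos_iff] at h2
      exact le_antisymm h1 h2
    have hle : LinearMap.ker (Fintype.linearCombination ℝ u) ≤ Submodule.span ℝ {c} := by
      intro μ hμ
      obtain ⟨t, ht⟩ := hu.exists_smul_eq hc hc0 huc ha hμ (hzero μ hμ)
      exact Submodule.mem_span_singleton.2 ⟨t, ht.symm⟩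
    have h1 := Submodule.finrank_mono hle
    have h2 := finrank_span_singleton (K := ℝ) hc0
    have h3 := LinearMap.finrank_range_add_finrank_ker (Fintype.linearCombination ℝ u)
    have h4 := Submodule.finrank_le (LinearMap.range (Fintype.linearCombination ℝ u))
    rw [Module.finrank_fintype_fun_eq_card] at h3
    omega
  obtain ⟨μ, hμ, hμa⟩ := hexists
  have hne : (Finset.univ.erase a).Nonempty := by
    rw [← Finset.card_pos, Finset.card_erase_of_mem (Finset.mem_univ a), Finset.card_univ]
    omega
  -- Moving μ along c until it reaches the boundary of the cone; the coefficient at a is unaffected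
  -- because c a = 0.
  obtain ⟨b, hb, hmin⟩ := Finset.exists_min_image (Finset.univ.erase a) (fun k => μ k / c k) hne
  have hba : b ≠ a := Finset.ne_of_mem_erase hb
  let ν : κ → ℝ := μ - (μ b / c b) • c
  have hνa : ν a = μ a := by simp [ν, ha]
  have hνb : ν b = 0 := by
    have := (hpos b hba).ne'
    simp only [ν, Pi.sub_apply, Pi.smul_apply, smul_eq_mul]
    field_simp
    ring
  have hν : 0 ≤ ν := by
    intro k
    by_cases hk : k = a
    · rw [hk, hνa]
      exact hμa.le
    · have := hmin k (by simp [hk])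
      rw [le_div_iff₀ (hpos k hk)] at this
      simpa [ν] using this
  have huν : Fintype.linearCombination ℝ u ν = 0 := by simp [ν, map_sub, map_smul, hμ, huc]
  have hν0 : ν ≠ 0 := fun h => by
    rw [h] at hνa
    exact hμa.ne hνa
  refine ⟨b, ⟨hba, ν, hν, hν0, huν, hνb⟩, ?_⟩
  rintro b' ⟨hb'a, η, hη, hη0, huη, hηb'⟩
  by_contra hbb'
  -- The combination of ν and η that vanishes at a is a multiple of c, but it is negative at b and
  -- positive at b'.
  obtain ⟨t, ht⟩ := hu.exists_smul_eq hc hc0 huc ha (b := η a • ν - ν a • η)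
    (by simp [map_sub, map_smul, huν, huη]) (by simp [mul_comm])
  have e1 := congrFun ht b
  have e2 := congrFun ht b'
  simp only [Pi.sub_apply, Pi.smul_apply, smul_eq_mul, hνb, hηb', mul_zero, zero_sub,
    sub_zero] at e1 e2
  have p1 : 0 < ν a := hνa ▸ hμa
  have p2 : 0 < η b := hu.pos hη hη0 huη hηb' (Ne.symm hbb')
  have p3 : 0 < η a := hu.pos hη hη0 huη hηb' (Ne.symm hb'a)
  have p4 : 0 < ν b' := hu.pos hν hν0 huν hνb hbb'
  have q1 : t < 0 := by
    by_contra! h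
    nlinarith [mul_nonneg h (hpos b hba).le, mul_pos p1 p2]
  have q2 : 0 < t := by
    by_contra! h
    nlinarith [mul_nonneg (neg_nonneg.2 h) (hpos b' hb'a).le, mul_pos p3 p4]
  exact q1.not_gt q2

end PositiveRelations

/-! ### The index of a simplex about the origin and its cocycle identity. -/

section Cocycle

open Fintype (linearCombination)

variable {ι : Type*} [Fintype ι]

/-- The family obtained from `u` by adding the vector `p`. -/
def cons {κ E : Type*} (p : E) (u : κ → E) : Option κ → E := fun o => o.elim p u

theorem linearCombination_cons {κ E : Type*} [Fintype κ] [AddCommGroup E] [Module ℝ E]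
    (p : E) (u : κ → E) (c : Option κ → ℝ) :
    linearCombination ℝ (cons p u) c = c none • p + linearCombination ℝ u fun k => c (some k) := by
  simp [Fintype.linearCombination_apply, Fintype.sum_option, cons]

theorem posDependentOff_none (p q : ι → ℝ) (V : Matrix ι ι ℝ) :
    PosDependentOff (cons p (cons q fun i => V i)) none ↔ PosDependent (cons q fun i => V i) := by
  constructor
  · rintro ⟨c, hc, hc0, huc, hn⟩
    refine ⟨fun k => c (some k), fun k => hc _, fun h => hc0 ?_, ?_⟩
    · ext o
      cases o with
      | none => exact hn
      | some k => exact congrFun h k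
    · rwa [linearCombination_cons, hn, zero_smul, zero_add] at huc
  · rintro ⟨c, hc, hc0, huc⟩
    refine ⟨fun o => o.elim 0 c, fun o => ?_, fun h => hc0 ?_, ?_, rfl⟩
    · cases o with
      | none => exact le_rfl
      | some k => exact hc k
    · ext k
      exact congrFun h (some k)
    · rw [linearCombination_cons]
      simpa using huc

theorem posDependentOff_some_none (p q : ι → ℝ) (V : Matrix ι ι ℝ) :
    PosDependentOff (cons p (cons q fun i => V i)) (some none) ↔
      PosDependent (cons p fun i => V i) := by
  constructor
  · rintro ⟨c, hc, hc0, huc, hn⟩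
    refine ⟨fun k => c (k.map some), fun k => hc _, fun h => hc0 ?_, ?_⟩
    · ext o
      rcases o with _ | _ | k
      · exact congrFun h none
      · exact hn
      · exact congrFun h (some k)
    · rw [linearCombination_cons, linearCombination_cons, hn, zero_smul, zero_add] at huc
      rw [linearCombination_cons]
      exact huc
  · rintro ⟨c, hc, hc0, huc⟩
    refine ⟨fun o => o.elim (c none) fun o => o.elim 0 fun k => c (some k), fun o => ?_,
      fun h => hc0 ?_, ?_, rfl⟩
    · rcases o with _ | _ | k
      · exact hc none
      · exact le_rfl
      · exact hc (some k)
    · ext k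
      rcases k with _ | k
      · exact congrFun h none
      · exact congrFun h (some (some k))
    · rw [linearCombination_cons, linearCombination_cons]
      rw [linearCombination_cons] at huc
      simpa using huc

variable [DecidableEq ι]

open Classical in
/-- The sign with which the simplex with the vertices `p` and the rows of `V` contains the
origin. -/
noncomputable def index (p : ι → ℝ) (V : Matrix ι ι ℝ) : ℤ :=
  if PosDependent (cons p fun i => V i) then (SignType.sign V.det : ℤ) else 0

/-- Cramer's rule, kept free of division so that α may have any sign or vanish. -/
theorem mul_det_updateRow {V : Matrix ι ι ℝ} {q : ι → ℝ} {α : ℝ} {β : ι → ℝ}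
    (h : α • q = linearCombination ℝ (fun i => V i) β) (m : ι) :
    α * (V.updateRow m q).det = β m * V.det := by
  rw [← Matrix.det_updateRow_smul, h, Fintype.linearCombination_apply,
    Matrix.det_updateRow_sum, smul_eq_mul]

theorem linearCombination_updateRow (V : Matrix ι ι ℝ) (m : ι) (q : ι → ℝ) (c : ι → ℝ) :
    linearCombination ℝ (fun i => V.updateRow m q i) c =
      c m • q + linearCombination ℝ (fun i => V i) (Function.update c m 0) := by
  rw [Fintype.linearCombination_apply, Fintype.linearCombination_apply,
    Fintype.sum_eq_add_sum_compl m, Fintype.sum_eq_add_sum_compl m]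
  simp only [Matrix.updateRow_self, Function.update_self, zero_smul, zero_add]
  congr 1
  refine Finset.sum_congr rfl fun k hk => ?_
  have hk : k ≠ m := by simpa using hk
  rw [Matrix.updateRow_ne hk, Function.update_of_ne hk]

variable (p q : ι → ℝ) (V : Matrix ι ι ℝ)

theorem posDependentOff_some_some (m : ι) :
    PosDependentOff (cons p (cons q fun i => V i)) (some (some m)) ↔
      PosDependent (cons p fun i => V.updateRow m q i) := by
  constructor
  · rintro ⟨c, hc, hc0, huc, hn⟩
    refine ⟨fun o => o.elim (c none) (Function.update (fun k => c (some (some k))) m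
      (c (some none))), fun o => ?_, fun h => hc0 ?_, ?_⟩
    · rcases o with _ | k
      · exact hc none
      · by_cases hk : k = m
        · subst hk
          simpa using hc (some none)
        · simpa [hk] using hc (some (some k))
    · ext o
      rcases o with _ | _ | k
      · exact congrFun h none
      · simpa using congrFun h (some m)
      · by_cases hk : k = m
        · subst hk
          exact hn
        · simpa [hk] using congrFun h (some k)
    · rw [linearCombination_cons, linearCombination_updateRow]
      rw [linearCombination_cons, linearCombination_cons] at huc
      have : Function.update (fun k => c (some (some k))) m 0 = fun k => c (some (some k)) := by
        rw [← hn]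
        exact Function.update_eq_self m (fun k => c (some (some k)))
      simpa [this] using huc
  · rintro ⟨c, hc, hc0, huc⟩
    refine ⟨fun o => o.elim (c none) fun o => o.elim (c (some m))
      (Function.update (fun k => c (some k)) m 0), fun o => ?_, fun h => hc0 ?_, ?_, ?_⟩
    · rcases o with _ | _ | k
      · exact hc none
      · exact hc (some m)
      · by_cases hk : k = m
        · subst hk
          simp
        · simpa [hk] using hc (some k)
    · ext k
      rcases k with _ | k
      · exact congrFun h none
      · by_cases hk : k = m
        · subst hk
          exact congrFun h (some none)
        · simpa [hk] using congrFun h (some (some k))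
    · rw [linearCombination_cons, linearCombination_cons]
      rw [linearCombination_cons, linearCombination_updateRow] at huc
      simpa using huc
    · simp

/-- The signed determinant of the facet opposite to a vertex of the prism over `V`. -/
noncomputable def facetDet : Option (Option ι) → ℝ
  | none => -V.det
  | some none => V.det
  | some (some m) => -(V.updateRow m q).det

variable {p q V}

/-- Eliminating p from the positive relations of the two facets gives a relation among q and the
rows of V, from which Cramer's rule reads off the ratio of the two determinants. Positivity of the
coefficients fixes its sign: the origin enters through one facet and leaves through the other. -/
theorem exists_facetDet_eq_neg (hu : RidgeFree (cons p (cons q fun i => V i)))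
    {a b : Option (Option ι)} (hab : a ≠ b)
    (ha : PosDependentOff (cons p (cons q fun i => V i)) a)
    (hb : PosDependentOff (cons p (cons q fun i => V i)) b) :
    ∃ s : ℝ, 0 < s ∧ facetDet q V a = -(s * facetDet q V b) := by
  have symm : ∀ x y : ℝ, (∃ s : ℝ, 0 < s ∧ x = -(s * y)) → ∃ s : ℝ, 0 < s ∧ y = -(s * x) := by
    rintro x y ⟨s, hs, h⟩
    refine ⟨s⁻¹, inv_pos.2 hs, ?_⟩
    rw [h]
    field_simp
  have key₁ : ∀ m, PosDependentOff (cons p (cons q fun i => V i)) none →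
      ∃ s : ℝ, 0 < s ∧ facetDet q V (some (some m)) = -(s * facetDet q V none) := by
    rintro m ⟨c, hc, hc0, huc, hn⟩
    have h1 : 0 < c (some none) := hu.pos hc hc0 huc hn (by simp)
    have h2 : 0 < c (some (some m)) := hu.pos hc hc0 huc hn (by simp)
    rw [linearCombination_cons, linearCombination_cons, hn, zero_smul, zero_add] at huc
    have h3 : (-c (some none)) • q = linearCombination ℝ (fun i => V i)
        (fun k => c (some (some k))) := by
      rw [neg_smul]
      exact neg_eq_of_add_eq_zero_right huc
    have h4 := mul_det_updateRow h3 m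
    refine ⟨c (some (some m)) / c (some none), div_pos h2 h1, ?_⟩
    simp only [facetDet]
    field_simp
    linarith
  have key₂ : ∀ m, PosDependentOff (cons p (cons q fun i => V i)) (some none) →
      PosDependentOff (cons p (cons q fun i => V i)) (some (some m)) →
      ∃ s : ℝ, 0 < s ∧ facetDet q V (some (some m)) = -(s * facetDet q V (some none)) := by
    rintro m ⟨c, hc, hc0, huc, hn⟩ ⟨b, hb, hb0, hub, hbn⟩
    have h1 : 0 < c none := hu.pos hc hc0 huc hn (by simp)
    have h2 : 0 < c (some (some m)) := hu.pos hc hc0 huc hn (by simp)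
    have h3 : 0 < b none := hu.pos hb hb0 hub hbn (by simp)
    have h4 : 0 < b (some none) := hu.pos hb hb0 hub hbn (by simp)
    have h5 : linearCombination ℝ (cons p (cons q fun i => V i)) (b none • c - c none • b) = 0 := by
      simp [map_sub, map_smul, huc, hub]
    rw [linearCombination_cons, linearCombination_cons] at h5
    simp only [Pi.sub_apply, Pi.smul_apply, smul_eq_mul, hn, mul_zero, zero_sub,
      mul_comm (b none) (c none), sub_self, zero_smul, zero_add, neg_smul] at h5
    have h6 := mul_det_updateRow (neg_add_eq_zero.1 h5) m
    simp only [hbn, mul_zero, sub_zero] at h6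
    refine ⟨b none * c (some (some m)) / (c none * b (some none)), by positivity, ?_⟩
    simp only [facetDet]
    field_simp
    linarith
  have key₃ : ∀ m m', m ≠ m' → PosDependentOff (cons p (cons q fun i => V i)) (some (some m)) →
      PosDependentOff (cons p (cons q fun i => V i)) (some (some m')) →
      ∃ s : ℝ, 0 < s ∧ facetDet q V (some (some m)) = -(s * facetDet q V (some (some m'))) := by
    rintro m m' hmm ⟨c, hc, hc0, huc, hn⟩ ⟨b, hb, hb0, hub, hbn⟩
    have h1 : 0 < c none := hu.pos hc hc0 huc hn (by simp)
    have h2 : 0 < c (some (some m')) := hu.pos hc hc0 huc hn (by simp [hmm.symm])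
    have h3 : 0 < b none := hu.pos hb hb0 hub hbn (by simp)
    have h4 : 0 < b (some (some m)) := hu.pos hb hb0 hub hbn (by simp [hmm])
    have h5 : linearCombination ℝ (cons p (cons q fun i => V i)) (b none • c - c none • b) = 0 := by
      simp [map_sub, map_smul, huc, hub]
    rw [linearCombination_cons, linearCombination_cons] at h5
    simp only [Pi.sub_apply, Pi.smul_apply, smul_eq_mul,
      mul_comm (b none) (c none), sub_self, zero_smul, zero_add] at h5
    let g : ι → ℝ := fun k => b none * c (some (some k)) - c none * b (some (some k))
    have h6 : (c none * b (some (some m))) • V m = linearCombination ℝ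
        (fun i => V.updateRow m q i) (Function.update g m
          (b none * c (some none) - c none * b (some none))) := by
      rw [linearCombination_updateRow, Function.update_self, Function.update_idem]
      have h7 : linearCombination ℝ (fun i => V i) g =
          g m • V m + linearCombination ℝ (fun i => V i) (Function.update g m 0) := by
        have := linearCombination_updateRow V m (V m) g
        rwa [Matrix.updateRow_eq_self] at this
      have h8 : g m = -(c none * b (some (some m))) := by simp [g, hn]
      change _ + linearCombination ℝ (fun i => V i) g = 0 at h5
      rw [h7, h8, neg_smul] at h5
      rw [eq_comm, ← sub_eq_zero, ← h5]
      abel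
    have h7 := mul_det_updateRow h6 m'
    -- The left matrix has the rows of `V.updateRow m' q`, with rows m and m' interchanged.
    have h8 : ((V.updateRow m q).updateRow m' (V m)).det = -(V.updateRow m' q).det := by
      have h9 : (V.updateRow m q).updateRow m' (V m) =
          (V.updateRow m' q).submatrix (Equiv.swap m m') id := by
        ext i j
        by_cases hi : i = m
        · simp [hi, hmm]
        · by_cases hi' : i = m'
          · simp [hi', hmm]
          · simp [Equiv.swap_apply_of_ne_of_ne hi hi', hi, hi']
      rw [h9, Matrix.det_permute, Equiv.Perm.sign_swap hmm]
      simp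
    rw [h8, Function.update_of_ne hmm.symm] at h7
    simp only [g, hbn, mul_zero, sub_zero] at h7
    refine ⟨c none * b (some (some m)) / (b none * c (some (some m'))), by positivity, ?_⟩
    simp only [facetDet]
    field_simp
    linarith
  rcases a with _ | _ | m <;> rcases b with _ | _ | m'
  · exact absurd rfl hab
  · exact ⟨1, one_pos, by simp [facetDet]⟩
  · exact symm _ _ (key₁ m' ha)
  · exact ⟨1, one_pos, by simp [facetDet]⟩
  · exact absurd rfl hab
  · exact symm _ _ (key₂ m' ha hb)
  · exact key₁ m hb
  · exact key₂ m hb ha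
  · exact key₃ m m' (fun h => hab (by rw [h])) ha hb

/-- The boundary of the boundary of a simplex on the points `p`, `q` and the rows of `V` has
winding number zero about the origin. -/
theorem index_eq_index_add_sum (hu : RidgeFree (cons p (cons q fun i => V i))) :
    index p V = index q V + ∑ m, index p (V.updateRow m q) := by
  classical
  let F : Option (Option ι) → ℤ := fun a =>
    if PosDependentOff (cons p (cons q fun i => V i)) a then
      (SignType.sign (facetDet q V a) : ℤ) else 0
  -- Either no facet contains the origin or exactly two do, with opposite signs.
  have hF : ∑ a, F a = 0 := by
    by_cases h : ∃ a, PosDependentOff (cons p (cons q fun i => V i)) a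
    · obtain ⟨a, ha⟩ := h
      obtain ⟨b, ⟨hba, hb⟩, huniq⟩ := hu.existsUnique_ne (by simp) ha
      rw [Fintype.sum_eq_add a b hba.symm]
      · obtain ⟨s, hs, h⟩ := exists_facetDet_eq_neg hu hba.symm ha hb
        simp only [F, if_pos ha, if_pos hb, h]
        rw [Left.sign_neg, sign_mul, sign_pos hs, one_mul]
        simp
      · rintro c ⟨hca, hcb⟩
        exact if_neg fun hc => hcb (huniq c ⟨hca, hc⟩)
    · push Not at h
      exact Finset.sum_eq_zero fun a _ => if_neg (h a)
  rw [Fintype.sum_option, Fintype.sum_option] at hF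
  simp only [F, posDependentOff_none, posDependentOff_some_none, posDependentOff_some_some,
    facetDet] at hF
  have hneg : ∀ (P : Prop) [Decidable P] (x : ℝ), (if P then (SignType.sign (-x) : ℤ) else 0) =
      -(if P then (SignType.sign x : ℤ) else 0) := by
    intro P _ x
    split_ifs
    · rw [Left.sign_neg]
      simp
    · simp
  simp only [hneg, Finset.sum_neg_distrib] at hF
  simp only [index]
  linarith

end Cocycle

/-! ### Linear symmetries of a centered simplex. -/

section SimplexSymmetry

variable {n : ℕ} {w : Affine.Simplex ℝ (EuclideanSpace ℝ (Fin n)) n}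

theorem eq_zero_of_sum_mul_points_eq_zero {c : Fin (n + 1) → ℝ}
    (hc : ∀ j, ∑ i, c i * w.points i j = 0) (hc1 : ∑ i, c i = 0) : c = 0 := by
  have h := affineIndependent_iff.1 w.independent Finset.univ c hc1 (by
    ext j
    simpa using hc j)
  ext i
  exact h i (Finset.mem_univ i)

theorem sum_points_apply (hw : ∑ i, w.points i = 0) (j : Fin n) : ∑ i, w.points i j = 0 := by
  have := congrArg (fun v : EuclideanSpace ℝ (Fin n) => v j) hw
  simpa using this

/-- The vertices of a centered simplex satisfy only one linear relation. -/
theorem eq_of_sum_mul_points_eq_zero (hw : ∑ i, w.points i = 0) {c : Fin (n + 1) → ℝ}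
    (hc : ∀ j, ∑ i, c i * w.points i j = 0) (i i' : Fin (n + 1)) : c i = c i' := by
  -- Subtracting the mean makes the coefficients sum to zero without spoiling the relation, so
  -- affine independence applies.
  have h := eq_zero_of_sum_mul_points_eq_zero (w := w)
    (c := fun i => c i - (∑ l, c l) / (n + 1)) (fun j => by
      simp only [sub_mul, Finset.sum_sub_distrib, hc j, ← Finset.mul_sum,
        sum_points_apply hw j, mul_zero, sub_zero]) (by
      simp only [Finset.sum_sub_distrib, Finset.sum_const, Finset.card_univ, Fintype.card_fin,
        nsmul_eq_mul]
      push_cast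
      field_simp
      ring)
  have h1 := congrFun h i
  have h2 := congrFun h i'
  simp only [Pi.zero_apply] at h1 h2
  linarith

/-- Every permutation of the vertices of a centered simplex is induced by a linear map whose
determinant is the sign of the permutation. -/
theorem exists_matrix_permuting_points (hw : ∑ i, w.points i = 0)
    (σ : Equiv.Perm (Fin (n + 1))) :
    ∃ B : Matrix (Fin n) (Fin n) ℝ, B.det = (Equiv.Perm.sign σ : ℤ) ∧
      ∀ i j, ∑ l, w.points i l * B l j = w.points (σ i) j := by
  let W : Matrix (Fin n) (Fin n) ℝ := Matrix.of fun i j => w.points i.castSucc j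
  let W' : Matrix (Fin n) (Fin n) ℝ := Matrix.of fun i j => w.points (σ i.castSucc) j
  have hW : W.det ≠ 0 := by
    intro h
    obtain ⟨v, hv, hvW⟩ := Matrix.exists_vecMul_eq_zero_iff.2 h
    apply hv
    have h := eq_of_sum_mul_points_eq_zero hw (c := Fin.snoc (α := fun _ => ℝ) v 0) (fun j => by
      rw [Fin.sum_univ_castSucc]
      have := congrFun hvW j
      simpa [Matrix.vecMul, dotProduct, W] using this)
    ext j
    simpa using h j.castSucc (Fin.last n)
  have hlast : ∀ j, w.points (Fin.last n) j = -∑ i : Fin n, w.points i.castSucc j := by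
    intro j
    have := sum_points_apply hw j
    rw [Fin.sum_univ_castSucc] at this
    linarith
  have hlast' : ∀ j, w.points (σ (Fin.last n)) j = -∑ i : Fin n, w.points (σ i.castSucc) j := by
    intro j
    have := sum_points_apply hw j
    rw [← Equiv.sum_comp σ, Fin.sum_univ_castSucc] at this
    linarith
  have hB : W * (W⁻¹ * W') = W' := by
    rw [← mul_assoc, Matrix.mul_nonsing_inv _ (isUnit_iff_ne_zero.2 hW), one_mul]
  have hperm : ∀ i j, ∑ l, w.points i l * (W⁻¹ * W') l j = w.points (σ i) j := by
    have hcast : ∀ (i : Fin n) j, ∑ l, w.points i.castSucc l * (W⁻¹ * W') l j =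
        w.points (σ i.castSucc) j := fun i j => congrFun (congrFun hB i) j
    intro i j
    refine Fin.lastCases ?_ (fun i => hcast i j) i
    rw [hlast' j]
    simp only [hlast, neg_mul, Finset.sum_neg_distrib, Finset.sum_mul]
    rw [Finset.sum_comm]
    simp only [hcast]
  refine ⟨W⁻¹ * W', ?_, hperm⟩
  -- Appending a column of ones to the matrix of vertices gives an invertible square matrix M on
  -- which B ⊕ 1 acts by permuting rows, so det B is the sign of σ. The choice of e is immaterial,
  -- since it enters both sides equally.
  let e : Fin (n + 1) ≃ Fin n ⊕ Unit := Fintype.equivOfCardEq (by simp)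
  let M : Matrix (Fin (n + 1)) (Fin n ⊕ Unit) ℝ :=
    Matrix.of fun i => Sum.elim (fun j => w.points i j) fun _ => 1
  have hM : (M.submatrix id e).det ≠ 0 := by
    intro h
    obtain ⟨v, hv, hvM⟩ := Matrix.exists_vecMul_eq_zero_iff.2 h
    apply hv
    have h' : ∀ s, ∑ i, v i * M i s = 0 := fun s => by
      have := congrFun hvM (e.symm s)
      simpa [Matrix.vecMul, dotProduct] using this
    exact eq_zero_of_sum_mul_points_eq_zero (w := w) (fun j => by simpa [M] using h' (Sum.inl j))
      (by simpa [M] using h' (Sum.inr ()))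
  have hprod : M.submatrix id e * (Matrix.fromBlocks (W⁻¹ * W') 0 0 (1 : Matrix Unit Unit ℝ)).submatrix
      e e = (M.submatrix id e).submatrix σ id := by
    rw [Matrix.submatrix_mul_equiv]
    ext i s
    rw [Matrix.submatrix_apply, Matrix.submatrix_apply, Matrix.submatrix_apply, Matrix.mul_apply,
      Fintype.sum_sum_type]
    rcases h : e s with j | j
    · simpa [M, h] using hperm i j
    · simp [M, h]
  have hdet := congrArg Matrix.det hprod
  rw [Matrix.det_mul, Matrix.det_permute, Matrix.det_submatrix_equiv_self,
    Matrix.det_fromBlocks_zero₂₁, Matrix.det_one, mul_one, mul_comm] at hdet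
  exact mul_right_cancel₀ hM hdet

end SimplexSymmetry

/-! ### Rook placements: cancellation by slides and invariance under permuting the classes. -/

section Rooks

variable {d n : ℕ} (w : Affine.Simplex ℝ (EuclideanSpace ℝ (Fin n)) n)

/-- The vectors `clone w i x` where `x` is the point with the number `(k, j)` and the `k`-th
permutation places it in the class `i`. -/
def rookMatrix (x : Fin (d + 1) × Fin n → Fin d → ℝ)
    (π : Fin (d + 1) → Equiv.Perm (Fin (n + 1))) :
    Matrix (Fin (d + 1) × Fin n) (Fin (d + 1) × Fin n) ℝ :=
  Matrix.of fun m => clone w (π m.1 m.2.castSucc) (x m)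

/-- The combinatorial sign of a tuple of permutations. -/
def rookSign (π : Fin (d + 1) → Equiv.Perm (Fin (n + 1))) : ℤ :=
  ∏ k, (Equiv.Perm.sign (π k) : ℤ)

/-- The degree of the rook configurations for arbitrary points `x` and `z`. -/
noncomputable def rookDegree (z : Fin d → ℝ) (x : Fin (d + 1) × Fin n → Fin d → ℝ) : ℤ :=
  ∑ π, rookSign π * index (clone w (Fin.last n) z) (rookMatrix w x π)

/-- Move the rook in the column `m` to the row that is not attacked. -/
def slide (m : Fin (d + 1) × Fin n) (π : Fin (d + 1) → Equiv.Perm (Fin (n + 1))) :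
    Fin (d + 1) → Equiv.Perm (Fin (n + 1)) :=
  Function.update π m.1 (π m.1 * Equiv.swap m.2.castSucc (Fin.last n))

theorem slide_involutive (m : Fin (d + 1) × Fin n) : Function.Involutive (slide m) := by
  intro π
  simp [slide, mul_assoc]

theorem rookSign_slide (m : Fin (d + 1) × Fin n) (π : Fin (d + 1) → Equiv.Perm (Fin (n + 1))) :
    rookSign (slide m π) = -rookSign π := by
  rw [rookSign, rookSign, Fintype.prod_eq_mul_prod_compl m.1, Fintype.prod_eq_mul_prod_compl m.1,
    ← neg_mul]
  congr 1
  · simp [slide, Equiv.Perm.sign_swap (Fin.castSucc_lt_last m.2).ne]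
  · refine Finset.prod_congr rfl fun k hk => ?_
    have hk : k ≠ m.1 := by simpa using hk
    simp [slide, hk]

theorem slide_apply_of_ne {m m' : Fin (d + 1) × Fin n} (h : m' ≠ m)
    (π : Fin (d + 1) → Equiv.Perm (Fin (n + 1))) :
    slide m π m'.1 m'.2.castSucc = π m'.1 m'.2.castSucc := by
  by_cases hk : m'.1 = m.1
  · have hj : m'.2 ≠ m.2 := fun hj => h (Prod.ext hk hj)
    rw [slide, hk, Function.update_self, Equiv.Perm.mul_apply, Equiv.swap_apply_of_ne_of_ne
      (fun h' => hj (Fin.castSucc_injective _ h')) (Fin.castSucc_lt_last _).ne]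
  · rw [slide, Function.update_of_ne hk]

theorem rookMatrix_slide_updateRow (x : Fin (d + 1) × Fin n → Fin d → ℝ)
    (m : Fin (d + 1) × Fin n) (π : Fin (d + 1) → Equiv.Perm (Fin (n + 1)))
    (q : Fin (d + 1) × Fin n → ℝ) :
    (rookMatrix w x (slide m π)).updateRow m q = (rookMatrix w x π).updateRow m q := by
  ext m' s
  by_cases h : m' = m
  · simp [h]
  · simp [h, rookMatrix, slide_apply_of_ne h]

/-- The terms cancel under the involution `slide m`: it affects only the overwritten row m and
reverses `rookSign`. -/
theorem sum_index_updateRow_eq_zero (x : Fin (d + 1) × Fin n → Fin d → ℝ)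
    (p : Fin (d + 1) × Fin n → ℝ) (m : Fin (d + 1) × Fin n)
    {q : (Fin (d + 1) → Equiv.Perm (Fin (n + 1))) → Fin (d + 1) × Fin n → ℝ}
    (hq : ∀ π, q (slide m π) = q π) :
    ∑ π, rookSign π * index p ((rookMatrix w x π).updateRow m (q π)) = 0 := by
  have h : ∑ π, rookSign π * index p ((rookMatrix w x π).updateRow m (q π)) =
      -∑ π, rookSign π * index p ((rookMatrix w x π).updateRow m (q π)) := by
    conv_lhs => rw [← Equiv.sum_comp (slide_involutive m).toPerm]
    rw [← Finset.sum_neg_distrib]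
    refine Finset.sum_congr rfl fun π _ => ?_
    rw [Function.Involutive.coe_toPerm, rookSign_slide, hq, rookMatrix_slide_updateRow, neg_mul]
  linarith

/-- The new vector is the same for every π, since z stays in the last class; so all correction terms
cancel, and this is an equality rather than a congruence. -/
theorem rookDegree_eq_of_ridgeFree {z z' : Fin d → ℝ} {x : Fin (d + 1) × Fin n → Fin d → ℝ}
    (h : ∀ π, RidgeFree (cons (clone w (Fin.last n) z) (cons (clone w (Fin.last n) z')
      fun m => rookMatrix w x π m))) :
    rookDegree w z x = rookDegree w z' x := by
  simp only [rookDegree]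
  rw [Finset.sum_congr rfl fun π _ => by rw [index_eq_index_add_sum (h π)]]
  simp only [mul_add, Finset.sum_add_distrib, Finset.mul_sum]
  rw [Finset.sum_comm (s := Finset.univ) (t := Finset.univ), add_eq_left]
  exact Finset.sum_eq_zero fun m _ => sum_index_updateRow_eq_zero w x _ m fun _ => rfl

/-- The symmetric group permuting the rows acts freely on the tuples of permutations. -/
theorem factorial_dvd_sum_of_invariant {f : (Fin (d + 1) → Equiv.Perm (Fin (n + 1))) → ℤ}
    (hf : ∀ (σ : Equiv.Perm (Fin (n + 1))) π, f (fun k => σ * π k) = f π) :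
    (((n + 1)! : ℕ) : ℤ) ∣ ∑ π, f π := by
  classical
  -- The r! fibres of π ↦ π 0 are translates of one another, so they have equal sums.
  have h : ∀ σ : Equiv.Perm (Fin (n + 1)),
      ∑ π : Fin (d + 1) → Equiv.Perm (Fin (n + 1)) with π 0 = σ, f π =
        ∑ π : Fin (d + 1) → Equiv.Perm (Fin (n + 1)) with π 0 = 1, f π := by
    intro σ
    refine Finset.sum_nbij' (fun π k => σ⁻¹ * π k) (fun π k => σ * π k) ?_ ?_ ?_ ?_ ?_
    · intro π hπ
      simp only [Finset.mem_filter, Finset.mem_univ, true_and] at hπ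
      simp [hπ]
    · intro π hπ
      simp only [Finset.mem_filter, Finset.mem_univ, true_and] at hπ
      simp [hπ]
    · intro π _
      simp
    · intro π _
      simp
    · intro π _
      exact (hf σ⁻¹ π).symm
  rw [← Finset.sum_fiberwise Finset.univ (fun π => π 0) f, Finset.sum_congr rfl fun σ _ => h σ,
    Finset.sum_const, Finset.card_univ, Fintype.card_perm, Fintype.card_fin, nsmul_eq_mul]
  exact dvd_mul_right _ _

theorem rookSign_mul (σ : Equiv.Perm (Fin (n + 1)))
    (π : Fin (d + 1) → Equiv.Perm (Fin (n + 1))) :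
    rookSign (fun k => σ * π k) = (Equiv.Perm.sign σ : ℤ) ^ (d + 1) * rookSign π := by
  simp [rookSign, Finset.prod_mul_distrib]

variable {w}

theorem clone_vecMul {B : Matrix (Fin n) (Fin n) ℝ} {σ : Equiv.Perm (Fin (n + 1))}
    (hB : ∀ i j, ∑ l, w.points i l * B l j = w.points (σ i) j) (i : Fin (n + 1))
    (x : Fin d → ℝ) :
    Matrix.vecMul (clone w i x) (Matrix.kroneckerMap (· * ·) (1 : Matrix (Fin (d + 1)) _ ℝ) B) =
      clone w (σ i) x := by
  ext ⟨k, j⟩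
  rw [Matrix.vecMul, dotProduct, Fintype.sum_prod_type, Finset.sum_eq_single k]
  · simp only [clone, Matrix.kroneckerMap_apply, Matrix.one_apply_eq, one_mul, mul_assoc,
      ← Finset.mul_sum, hB]
  · intro k' _ hk'
    simp [Matrix.one_apply_ne hk']
  · simp

/-- The map I ⊗ B carries clones of class i to clones of class σ i and has determinant sgn(σ)^(d+1).
The same factor appears in `rookSign`, and the two cancel. -/
theorem rookSign_mul_index_eq (hw : ∑ i, w.points i = 0) (x : Fin (d + 1) × Fin n → Fin d → ℝ)
    (y : Fin d → ℝ) (σ : Equiv.Perm (Fin (n + 1))) (i : Fin (n + 1))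
    (π : Fin (d + 1) → Equiv.Perm (Fin (n + 1))) :
    rookSign (fun k => σ * π k) * index (clone w (σ i) y) (rookMatrix w x fun k => σ * π k) =
      rookSign π * index (clone w i y) (rookMatrix w x π) := by
  obtain ⟨B, hdet, hB⟩ := exists_matrix_permuting_points hw σ
  let K := Matrix.kroneckerMap (· * ·) (1 : Matrix (Fin (d + 1)) (Fin (d + 1)) ℝ) B
  have hKdet : K.det = ((Equiv.Perm.sign σ : ℤ) : ℝ) ^ (d + 1) := by
    simp only [K]
    rw [Matrix.det_kronecker, Matrix.det_one, one_pow, one_mul, hdet, Fintype.card_fin]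
  have hrow : ∀ m, rookMatrix w x (fun k => σ * π k) m = Matrix.vecMul (rookMatrix w x π m) K :=
    fun m => (clone_vecMul hB _ _).symm
  have hmul : rookMatrix w x (fun k => σ * π k) = rookMatrix w x π * K := by
    ext m s
    rw [hrow, Matrix.mul_apply_eq_vecMul]
  have hKinj : Function.Injective (fun v => Matrix.vecMul v K) := by
    apply Matrix.vecMul_injective_of_isUnit
    rw [Matrix.isUnit_iff_isUnit_det, hKdet]
    rcases Int.units_eq_one_or (Equiv.Perm.sign σ) with h | h <;> simp [h]
  have hdep : PosDependent (cons (clone w (σ i) y) fun m => rookMatrix w x (fun k => σ * π k) m) ↔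
      PosDependent (cons (clone w i y) fun m => rookMatrix w x π m) := by
    have : ∀ c : Option (Fin (d + 1) × Fin n) → ℝ, Fintype.linearCombination ℝ
        (cons (clone w (σ i) y) fun m => rookMatrix w x (fun k => σ * π k) m) c =
        Matrix.vecMul (Fintype.linearCombination ℝ
          (cons (clone w i y) fun m => rookMatrix w x π m) c) K := by
      intro c
      rw [linearCombination_cons, linearCombination_cons, Matrix.add_vecMul, Matrix.smul_vecMul,
        clone_vecMul hB, Fintype.linearCombination_apply, Fintype.linearCombination_apply]
      congr 1
      refine Eq.trans ?_ (map_sum K.vecMulLinear _ _).symm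
      refine Finset.sum_congr rfl fun m _ => ?_
      rw [map_smul, Matrix.vecMulLinear_apply, hrow]
    simp only [PosDependent, this]
    refine exists_congr fun c => and_congr_right fun _ => and_congr_right fun _ => ?_
    exact ⟨fun h => hKinj (by simpa using h), fun h => by rw [h, Matrix.zero_vecMul]⟩
  have hdet' : (rookMatrix w x fun k => σ * π k).det =
      (rookMatrix w x π).det * ((Equiv.Perm.sign σ ^ (d + 1) : ℤˣ) : ℤ) := by
    rw [hmul, Matrix.det_mul, hKdet]
    push_cast
    rfl
  have hsign : rookSign (fun k => σ * π k) =
      ((Equiv.Perm.sign σ ^ (d + 1) : ℤˣ) : ℤ) * rookSign π := by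
    rw [rookSign_mul]
    push_cast
    rfl
  by_cases hP : PosDependent (cons (clone w i y) fun m => rookMatrix w x π m)
  · rw [index, index, if_pos hP, if_pos (hdep.2 hP), hdet', hsign]
    rcases Int.units_eq_one_or (Equiv.Perm.sign σ ^ (d + 1)) with h | h
    · simp [h]
    · simp [h, Left.sign_neg]
  · rw [index, index, if_neg hP, if_neg (hdep.not.2 hP), mul_zero, mul_zero]

theorem rookMatrix_update (x : Fin (d + 1) × Fin n → Fin d → ℝ) (m : Fin (d + 1) × Fin n)
    (y : Fin d → ℝ) (π : Fin (d + 1) → Equiv.Perm (Fin (n + 1))) :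
    rookMatrix w (Function.update x m y) π =
      (rookMatrix w x π).updateRow m (clone w (π m.1 m.2.castSucc) y) := by
  ext m' s
  by_cases h : m' = m
  · subst h
    simp [rookMatrix]
  · simp [rookMatrix, h]

/-- Here the new vector depends on π through column m only. The terms for the other columns cancel,
column m gives the new degree, and what is left is the invariant sum divisible by r!. -/
theorem rookDegree_update_modEq (hw : ∑ i, w.points i = 0) {z : Fin d → ℝ}
    {x : Fin (d + 1) × Fin n → Fin d → ℝ} {m : Fin (d + 1) × Fin n} {y : Fin d → ℝ}
    (h : ∀ π : Fin (d + 1) → Equiv.Perm (Fin (n + 1)),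
      RidgeFree (cons (clone w (Fin.last n) z) (cons (clone w (π m.1 m.2.castSucc) y)
        fun m => rookMatrix w x π m))) :
    rookDegree w z x ≡ rookDegree w z (Function.update x m y) [ZMOD ((n + 1)! : ℕ)] := by
  have h1 : rookDegree w z x = ∑ π, rookSign π * index (clone w (π m.1 m.2.castSucc) y)
      (rookMatrix w x π) + rookDegree w z (Function.update x m y) := by
    simp only [rookDegree]
    rw [Finset.sum_congr rfl fun π _ => by rw [index_eq_index_add_sum (h π)]]
    simp only [mul_add, Finset.sum_add_distrib, Finset.mul_sum]
    rw [Finset.sum_comm (s := Finset.univ) (t := Finset.univ), Fintype.sum_eq_single m]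
    · simp only [rookMatrix_update]
    · intro m' hm'
      exact sum_index_updateRow_eq_zero w x _ m' fun π => by rw [slide_apply_of_ne hm'.symm]
  refine (Int.modEq_iff_dvd.2 ?_).symm
  rw [h1, add_sub_cancel_right]
  exact factorial_dvd_sum_of_invariant fun σ π => rookSign_mul_index_eq hw x y σ _ π

end Rooks

/-! ### Density of general position. -/

section GeneralPosition

/-- Each slot is to receive every label but one. Let label i be the missing one in exactly |K| - a_i
slots, where a_i is its multiplicity; the cardinality hypothesis makes these numbers add up to |K|.
The a_i items labelled i are then matched with the remaining slots. -/
theorem exists_slots {ι K L : Type*} [Fintype ι] [Fintype K] [Fintype L] [DecidableEq L]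
    {l : ι → L} (hl : ∀ i, (Finset.univ.filter fun m => l m = i).card ≤ Fintype.card K)
    (hcard : Fintype.card ι + Fintype.card K = Fintype.card K * Fintype.card L) :
    ∃ (s : ι → K) (μ : K → L), (∀ m m', s m = s m' → l m = l m' → m = m') ∧
      ∀ m, l m ≠ μ (s m) := by
  classical
  let a : L → ℕ := fun i => (Finset.univ.filter fun m => l m = i).card
  have ha : ∑ i, a i = Fintype.card ι :=
    (Finset.card_eq_sum_card_fiberwise fun m _ => Finset.mem_univ (l m)).symm
  have hb : ∑ i, (Fintype.card K - a i) = Fintype.card K := by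
    have : ∑ i, (Fintype.card K - a i) + ∑ i, a i = Fintype.card K * Fintype.card L := by
      rw [← Finset.sum_add_distrib, Finset.sum_congr rfl fun i _ => Nat.sub_add_cancel (hl i)]
      simp [mul_comm]
    omega
  let e : K ≃ Σ i, Fin (Fintype.card K - a i) := Fintype.equivOfCardEq (by simp [hb])
  let μ : K → L := fun s => (e s).1
  have hμ : ∀ i, Fintype.card {s // μ s = i} = Fintype.card K - a i := by
    intro i
    have e' : {s // μ s = i} ≃ Fin (Fintype.card K - a i) :=
      (e.subtypeEquiv (q := fun p => p.1 = i) fun s => Iff.rfl).trans (Equiv.sigmaSubtype i)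
    rw [Fintype.card_congr e', Fintype.card_fin]
  have hE : ∀ i, Nonempty ({m // l m = i} ≃ {s // μ s ≠ i}) := by
    intro i
    rw [← Fintype.card_eq, Fintype.card_subtype_compl, hμ, Fintype.card_subtype]
    have : a i ≤ Fintype.card K := hl i
    change a i = _
    omega
  have E := fun i => (hE i).some
  refine ⟨fun m => (E (l m) ⟨m, rfl⟩).1, μ, fun m m' hs hm => ?_, fun m =>
    (E (l m) ⟨m, rfl⟩).2.symm⟩
  have key : ∀ i (h : l m = i) (h' : l m' = i),
      (E i ⟨m, h⟩ : K) = E i ⟨m', h'⟩ → m = m' := fun i h h' hh =>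
    congrArg Subtype.val ((E i).injective (Subtype.ext hh))
  have hcast : ∀ i (h : l m' = i), (E (l m') ⟨m', rfl⟩ : K) = E i ⟨m', h⟩ := by
    rintro i rfl
    rfl
  exact key (l m) rfl hm.symm (hs.trans (hcast _ hm.symm))

variable {d n : ℕ} {w : Affine.Simplex ℝ (EuclideanSpace ℝ (Fin n)) n}

theorem plus_last (x : Fin d → ℝ) : plus x (Fin.last d) = 1 := by simp [plus]

theorem plus_castSucc (x : Fin d → ℝ) (k : Fin d) : plus x k.castSucc = x k := by simp [plus]

/-- The points are put at the d + 1 vertices of an affine simplex so that the labels at each vertex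
are distinct and omit one. The lifted vertices (x, 1) form a basis of the first tensor factor, and
any r - 1 of the w_i form a basis of the second. -/
theorem exists_det_clone_ne_zero (hw : ∑ i, w.points i = 0)
    {l : Fin (d + 1) × Fin n → Fin (n + 1)}
    (hl : ∀ i, (Finset.univ.filter fun m => l m = i).card ≤ d + 1) :
    ∃ y : Fin (d + 1) × Fin n → Fin d → ℝ,
      (Matrix.of fun m => clone w (l m) (y m)).det ≠ 0 := by
  classical
  obtain ⟨s, μ, hinj, hμ⟩ := exists_slots (K := Fin (d + 1)) (by simpa using hl)
    (by simp only [Fintype.card_prod, Fintype.card_fin]; ring)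
  -- Slot k < d is the k-th standard basis vector, and the last slot is the origin.
  refine ⟨fun m k => if s m = k.castSucc then 1 else 0, fun hdet => ?_⟩
  obtain ⟨v, hv, hvM⟩ := Matrix.exists_vecMul_eq_zero_iff.2 hdet
  apply hv
  have hcol : ∀ k j, ∑ m, v m * (plus (fun k : Fin d => if s m = k.castSucc then (1 : ℝ) else 0) k *
      w.points (l m) j) = 0 := fun k j => by
    simpa [Matrix.vecMul, dotProduct, clone] using congrFun hvM (k, j)
  have hslot : ∀ (k : Fin d) j,
      ∑ m, (if s m = k.castSucc then v m * w.points (l m) j else 0) = 0 := by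
    intro k j
    refine (Finset.sum_congr rfl fun m _ => ?_).trans (hcol k.castSucc j)
    rw [plus_castSucc]
    split_ifs <;> simp
  have hall : ∀ (k : Fin (d + 1)) j,
      ∑ m, (if s m = k then v m * w.points (l m) j else 0) = 0 := by
    intro k j
    refine Fin.lastCases ?_ (fun k => hslot k j) k
    -- The last coordinate of every lifted point is 1, so its column gives the total over all slots;
    -- subtracting the other slots isolates the last one.
    have h1 : ∑ k, ∑ m, (if s m = k then v m * w.points (l m) j else 0) = 0 := by
      rw [Finset.sum_comm]
      simp only [Finset.sum_ite_eq, Finset.mem_univ, if_true]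
      rw [← hcol (Fin.last d) j]
      simp [plus_last]
    rw [Fin.sum_univ_castSucc] at h1
    simpa [hslot] using h1
  have hzero : ∀ k i, ∑ m, (if s m = k ∧ l m = i then v m else 0) = 0 := by
    intro k i
    -- All coefficients of a relation among the w_i agree, and that of the omitted label μ k is
    -- zero.
    rw [eq_of_sum_mul_points_eq_zero hw
      (c := fun i => ∑ m, (if s m = k ∧ l m = i then v m else 0)) (fun j => ?_) i (μ k)]
    · refine Finset.sum_eq_zero fun m _ => if_neg ?_
      rintro ⟨rfl, h⟩
      exact hμ m h
    · simp only [Finset.sum_mul]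
      rw [Finset.sum_comm]
      refine (Finset.sum_congr rfl fun m _ => ?_).trans (hall k j)
      rw [Finset.sum_eq_single (l m)]
      · by_cases h : s m = k <;> simp [h]
      · intro i _ hi
        simp [hi.symm]
      · simp
  ext m
  have h := hzero (s m) (l m)
  rw [Finset.sum_eq_single m (fun m' _ hm' => if_neg fun h => hm' (hinj _ _ h.1 h.2)) (by simp)] at h
  simpa using h

theorem continuous_clone (i : Fin (n + 1)) : Continuous (clone (d := d) w i) := by
  refine continuous_pi fun p => Continuous.mul ?_ continuous_const
  refine Fin.lastCases ?_ (fun k => ?_) p.1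
  · simpa only [plus_last] using continuous_const
  · simpa only [plus_castSucc] using continuous_apply k

theorem clone_lineMap (i : Fin (n + 1)) (x y : Fin d → ℝ) (t : ℝ) :
    clone w i (x + t • (y - x)) = clone w i x + t • (clone w i y - clone w i x) := by
  ext ⟨k, j⟩
  refine Fin.lastCases ?_ (fun k => ?_) k
  · simp [clone, plus_last]
  · simp only [clone, plus_castSucc, Pi.add_apply, Pi.smul_apply, Pi.sub_apply, smul_eq_mul]
    ring

variable {T : Type*}

theorem isOpen_det_clone_ne_zero (g : Fin (d + 1) × Fin n → T)
    (l : Fin (d + 1) × Fin n → Fin (n + 1)) :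
    IsOpen {X : T → Fin d → ℝ | (Matrix.of fun m => clone w (l m) (X (g m))).det ≠ 0} := by
  refine isOpen_ne_fun (Continuous.matrix_det ?_) continuous_const
  exact continuous_pi fun m => (continuous_clone (l m)).comp (continuous_apply (g m))

/-- On the line from X to a configuration with nonzero determinant, the determinant is a nonzero
polynomial in t, hence nonzero for parameters arbitrarily close to 0. -/
theorem dense_det_clone_ne_zero (hw : ∑ i, w.points i = 0) {g : Fin (d + 1) × Fin n → T}
    (hg : Function.Injective g) {l : Fin (d + 1) × Fin n → Fin (n + 1)}
    (hl : ∀ i, (Finset.univ.filter fun m => l m = i).card ≤ d + 1) :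
    Dense {X : T → Fin d → ℝ | (Matrix.of fun m => clone w (l m) (X (g m))).det ≠ 0} := by
  intro X
  obtain ⟨y, hy⟩ := exists_det_clone_ne_zero hw hl
  let Y : T → Fin d → ℝ := Function.extend g y 0
  let A : Matrix (Fin (d + 1) × Fin n) (Fin (d + 1) × Fin n) ℝ :=
    Matrix.of fun m => clone w (l m) (X (g m))
  let B : Matrix (Fin (d + 1) × Fin n) (Fin (d + 1) × Fin n) ℝ :=
    Matrix.of fun m => clone w (l m) (y m)
  let P : Polynomial ℝ :=
    (A.map Polynomial.C + (Polynomial.X : Polynomial ℝ) • (B - A).map Polynomial.C).det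
  have hP : ∀ t : ℝ, P.eval t = (A + t • (B - A)).det := by
    intro t
    rw [← Polynomial.coe_evalRingHom, RingHom.map_det]
    congr 1
    ext i j
    simp
  have hline : ∀ t : ℝ, (Matrix.of fun m => clone w (l m) ((X + t • (Y - X)) (g m))) =
      A + t • (B - A) := by
    intro t
    ext m s
    have h1 : (X + t • (Y - X)) (g m) = X (g m) + t • (y m - X (g m)) := by
      simp [Y, hg.extend_apply]
    rw [Matrix.of_apply, h1, clone_lineMap]
    rfl
  have hP0 : P ≠ 0 := by
    intro h
    apply hy
    have := hP 1
    rw [h] at this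
    simpa using this.symm
  have hdense : Dense {t : ℝ | P.eval t ≠ 0} := by
    have h : {t : ℝ | P.eval t ≠ 0} = {t | P.IsRoot t}ᶜ := rfl
    rw [h]
    exact (P.finite_setOfPred_isRoot hP0).countable.dense_compl ℝ
  have hcont : Continuous fun t : ℝ => X + t • (Y - X) := by fun_prop
  have h0 := map_mem_closure hcont (hdense 0) (t := {X : T → Fin d → ℝ |
    (Matrix.of fun m => clone w (l m) (X (g m))).det ≠ 0}) (fun t ht => by
      rw [Set.mem_ofPred_eq, hline, ← hP]
      exact ht)
  simpa using h0

/-- For every labelling of the points by classes, at most `N` of the labelled clones do not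
satisfy a nontrivial nonnegative linear relation. -/
def InGeneralPosition [Fintype T] (w : Affine.Simplex ℝ (EuclideanSpace ℝ (Fin n)) n)
    (X : T → Fin d → ℝ) : Prop :=
  ∀ (l : T → Fin (n + 1)) (c : T → ℝ), 0 ≤ c →
    (Finset.univ.filter fun t => c t ≠ 0).card ≤ (d + 1) * n →
    Fintype.linearCombination ℝ (fun t => clone w (l t) (X t)) c = 0 → c = 0

/-- Greedy: as long as the total capacity is not exhausted, some label has room for one more
element. -/
theorem exists_extend_labels {L : Type*} [Fintype L] [DecidableEq L] [DecidableEq T] {N : ℕ}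
    {S : Finset T} {l : T → L} (hl : ∀ i, (S.filter fun t => l t = i).card ≤ N) (Q : Finset T)
    (hQ : (S ∪ Q).card ≤ N * Fintype.card L) :
    ∃ l' : T → L, (∀ t ∈ S, l' t = l t) ∧
      ∀ i, ((S ∪ Q).filter fun t => l' t = i).card ≤ N := by
  induction Q using Finset.induction_on with
  | empty => exact ⟨l, fun _ _ => rfl, by simpa using hl⟩
  | insert a Q ha ih =>
    rw [Finset.union_insert] at hQ ⊢
    obtain ⟨l', h1, h2⟩ := ih ((Finset.card_le_card (Finset.subset_insert _ _)).trans hQ)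
    by_cases haS : a ∈ S ∪ Q
    · rw [Finset.insert_eq_of_mem haS]
      exact ⟨l', h1, h2⟩
    rw [Finset.card_insert_of_notMem haS] at hQ
    have : ∃ i, ((S ∪ Q).filter fun t => l' t = i).card < N := by
      by_contra! hcon
      have h3 : (S ∪ Q).card = ∑ i, ((S ∪ Q).filter fun t => l' t = i).card :=
        Finset.card_eq_sum_card_fiberwise fun m _ => Finset.mem_univ (l' m)
      have h4 := Finset.sum_le_sum fun i (_ : i ∈ (Finset.univ : Finset L)) => hcon i
      rw [← h3, Finset.sum_const, Finset.card_univ, smul_eq_mul, mul_comm] at h4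
      omega
    obtain ⟨i, hi⟩ := this
    have hup : ∀ j, (S ∪ Q).filter (fun t => Function.update l' a i t = j) =
        (S ∪ Q).filter fun t => l' t = j := fun j => Finset.filter_congr fun t ht => by
      rw [Function.update_of_ne (ne_of_mem_of_not_mem ht haS)]
    refine ⟨Function.update l' a i, fun t ht => ?_, fun j => ?_⟩
    · rw [Function.update_of_ne (ne_of_mem_of_not_mem (Finset.mem_union_left _ ht) haS), h1 t ht]
    · rw [Finset.filter_insert, Function.update_self, hup]
      split_ifs with hij
      · subst hij
        exact (Finset.card_insert_le _ _).trans hi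
      · exact h2 j

variable [Fintype T]

/-- Carathéodory reduction: a nonnegative relation of minimal support has at most `d + 1`
vertices in each class. -/
theorem exists_relation_card_le {X : T → Fin d → ℝ} {l : T → Fin (n + 1)} (c : T → ℝ)
    (hc : 0 ≤ c) (hc0 : c ≠ 0)
    (hrel : Fintype.linearCombination ℝ (fun t => clone w (l t) (X t)) c = 0) :
    ∃ b : T → ℝ, 0 ≤ b ∧ b ≠ 0 ∧
      Fintype.linearCombination ℝ (fun t => clone w (l t) (X t)) b = 0 ∧
      (Finset.univ.filter fun t => b t ≠ 0).card ≤ (Finset.univ.filter fun t => c t ≠ 0).card ∧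
      ∀ i, ((Finset.univ.filter fun t => b t ≠ 0).filter fun t => l t = i).card ≤ d + 1 := by
  classical
  induction hN : (Finset.univ.filter fun t => c t ≠ 0).card using Nat.strong_induction_on
    generalizing c with
  | _ N ih =>
  by_cases hfib : ∀ i, ((Finset.univ.filter fun t => c t ≠ 0).filter fun t => l t = i).card ≤ d + 1
  · exact ⟨c, hc, hc0, hrel, hN.le, hfib⟩
  push Not at hfib
  obtain ⟨i, hi⟩ := hfib
  let S := (Finset.univ.filter fun t => c t ≠ 0).filter fun t => l t = i
  -- More than d + 1 lifted points in ℝ^(d+1) are dependent, and within a single class this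
  -- dependence passes to the clones.
  obtain ⟨a, haS, hsum, hpos⟩ : ∃ a : T → ℝ, (∀ t ∉ S, a t = 0) ∧
      ∑ t, a t • plus (X t) = 0 ∧ ∃ t, 0 < a t := by
    have hdep : ¬LinearIndependent ℝ fun t : S => plus (X t) := fun h => by
      have := h.fintype_card_le_finrank
      rw [Fintype.card_coe, Module.finrank_fintype_fun_eq_card, Fintype.card_fin] at this
      exact hi.not_ge this
    obtain ⟨g, hg, t₀, ht₀⟩ := Fintype.not_linearIndependent_iff.1 hdep
    have key : ∀ g : S → ℝ, ∑ t, g t • plus (X t) = 0 → (∃ t, 0 < g t) →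
        ∃ a : T → ℝ, (∀ t ∉ S, a t = 0) ∧ ∑ t, a t • plus (X t) = 0 ∧ ∃ t, 0 < a t := by
      rintro g hg ⟨t₀, ht₀⟩
      let a : T → ℝ := fun t => if h : t ∈ S then g ⟨t, h⟩ else 0
      have ha : ∀ t : S, a t = g t := fun t => dif_pos t.2
      have ha' : ∀ t ∉ S, a t = 0 := fun t ht => dif_neg ht
      refine ⟨a, ha', ?_, t₀, by rwa [ha]⟩
      rw [← hg]
      refine (Fintype.sum_of_injective Subtype.val Subtype.val_injective _ _ ?_ ?_).symm
      · intro t ht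
        rw [ha' t fun h => ht ⟨⟨t, h⟩, rfl⟩, zero_smul]
      · intro t
        rw [ha]
    rcases lt_or_gt_of_ne ht₀ with h | h
    · exact key (-g) (by simp only [Pi.neg_apply, neg_smul, Finset.sum_neg_distrib, hg, neg_zero]) ⟨t₀, by simpa using h⟩
    · exact key g hg ⟨t₀, h⟩
  have hal : ∀ t, a t ≠ 0 → l t = i ∧ c t ≠ 0 := by
    intro t ht
    have : t ∈ S := by
      by_contra h
      exact ht (haS t h)
    simpa [S, and_comm] using this
  have harel : Fintype.linearCombination ℝ (fun t => clone w (l t) (X t)) a = 0 := by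
    ext ⟨k, j⟩
    have h1 := congrFun hsum k
    rw [Finset.sum_apply] at h1
    rw [Fintype.linearCombination_apply, Finset.sum_apply]
    calc ∑ t, (a t • clone w (l t) (X t)) (k, j)
        = ∑ t, (a t • plus (X t)) k * w.points i j := by
          refine Finset.sum_congr rfl fun t _ => ?_
          by_cases ht : a t = 0
          · simp [ht]
          · simp [clone, (hal t ht).1, mul_assoc]
      _ = 0 := by rw [← Finset.sum_mul, h1, Pi.zero_apply, zero_mul]
  -- The last coordinate of the lifted points gives Σ a = 0. Subtracting a multiple of a thus
  -- preserves the positive sum of c, which keeps the reduced relation nontrivial.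
  have hasum : ∑ t, a t = 0 := by
    have := congrFun hsum (Fin.last d)
    simpa [Finset.sum_apply, plus_last] using this
  obtain ⟨s, hs, hnn, t, hct, hbt⟩ := exists_sub_smul_nonneg hc (fun t ht => by
    by_contra h
    exact (hal t fun h' => h h'.le).2 ht) hpos
  have hsub : (Finset.univ.filter fun t => (c - s • a) t ≠ 0) ⊂
      Finset.univ.filter fun t => c t ≠ 0 := by
    refine Finset.ssubset_iff_subset_ne.2 ⟨fun t' ht' => ?_, fun h => ?_⟩
    · simp only [Finset.mem_filter, Finset.mem_univ, true_and] at ht' ⊢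
      intro h
      have : a t' = 0 := by
        by_contra h'
        exact (hal t' h').2 h
      exact ht' (by simp [h, this])
    · have : t ∈ Finset.univ.filter fun t => c t ≠ 0 := by simpa using hct
      rw [← h] at this
      simp only [Finset.mem_filter, Finset.mem_univ, true_and] at this
      exact this (by simpa using hbt)
  have hb0 : c - s • a ≠ 0 := by
    intro h
    have h1 : ∑ t, (c - s • a) t = 0 := by rw [h]; simp
    simp only [Pi.sub_apply, Pi.smul_apply, smul_eq_mul, Finset.sum_sub_distrib, ← Finset.mul_sum,
      hasum, mul_zero, sub_zero] at h1
    exact hc0 (funext fun t => (Finset.sum_eq_zero_iff_of_nonneg fun t _ => hc t).1 h1 t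
      (Finset.mem_univ t))
  have hlt := Finset.card_lt_card hsub
  obtain ⟨b, hb, hb0, hbrel, hbcard, hbfib⟩ := ih _ (hN ▸ hlt) (c - s • a) hnn hb0
    (by simp [map_sub, map_smul, hrel, harel]) rfl
  exact ⟨b, hb, hb0, hbrel, hN ▸ hbcard.trans hlt.le, hbfib⟩

/-- After the reduction, the support is enlarged to exactly N points, and the added points are
relabelled so that no class exceeds d + 1. The relation then lies in the left kernel of a
nonsingular matrix. -/
theorem inGeneralPosition_of_det_ne_zero (hT : (d + 1) * n ≤ Fintype.card T) {X : T → Fin d → ℝ}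
    (h : ∀ (g : Fin (d + 1) × Fin n → T) (l : Fin (d + 1) × Fin n → Fin (n + 1)),
      Function.Injective g → (∀ i, (Finset.univ.filter fun m => l m = i).card ≤ d + 1) →
      (Matrix.of fun m => clone w (l m) (X (g m))).det ≠ 0) : InGeneralPosition w X := by
  classical
  intro l c hc hcard hrel
  by_contra hc0
  obtain ⟨b, hb, hb0, hbrel, hbcard, hbfib⟩ := exists_relation_card_le c hc hc0 hrel
  obtain ⟨Q, hSQ, hQ⟩ := Finset.exists_superset_card_eq (hbcard.trans hcard) hT
  have hunion : (Finset.univ.filter fun t => b t ≠ 0) ∪ Q = Q := Finset.union_eq_right.2 hSQ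
  obtain ⟨l', hl', hfib⟩ := exists_extend_labels hbfib Q (by
    rw [hunion, hQ, Fintype.card_fin]
    exact Nat.mul_le_mul_left _ (Nat.le_succ n))
  rw [hunion] at hfib
  let e : Fin (d + 1) × Fin n ≃ Q := Fintype.equivOfCardEq (by simp [hQ])
  have hg : Function.Injective fun m => (e m : T) := Subtype.val_injective.comp e.injective
  refine h (fun m => e m) (fun m => l' (e m)) hg (fun i => ?_)
    (Matrix.exists_vecMul_eq_zero_iff.1 ⟨fun m => b (e m), fun h0 => ?_, ?_⟩)
  · refine (Finset.card_le_card_of_injOn (fun m => (e m : T)) (fun m hm => ?_) hg.injOn).trans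
      (hfib i)
    simpa using hm
  · obtain ⟨t, ht⟩ := Function.ne_iff.1 hb0
    have htQ : t ∈ Q := hSQ (by simpa using ht)
    have := congrFun h0 (e.symm ⟨t, htQ⟩)
    simp only [Equiv.apply_symm_apply] at this
    exact ht this
  · rw [← hbrel, Fintype.linearCombination_apply, Matrix.vecMul_eq_sum]
    refine Fintype.sum_of_injective _ hg _ _ (fun t ht => ?_) (fun m => ?_)
    · have : b t = 0 := by
        by_contra h0
        have htQ : t ∈ Q := hSQ (by simpa using h0)
        exact ht ⟨e.symm ⟨t, htQ⟩, by simp⟩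
      rw [this, zero_smul]
    · by_cases h0 : b (e m) = 0
      · simp [h0]
      · have hl := hl' _ (by simpa using h0)
        change b (e m) • clone w (l' (e m)) (X (e m)) = _
        rw [hl]

theorem dense_inGeneralPosition (hw : ∑ i, w.points i = 0) (hT : (d + 1) * n ≤ Fintype.card T) :
    Dense {X : T → Fin d → ℝ | InGeneralPosition w X} := by
  classical
  let I : Set ((Fin (d + 1) × Fin n → T) × (Fin (d + 1) × Fin n → Fin (n + 1))) :=
    {p | Function.Injective p.1 ∧ ∀ i, (Finset.univ.filter fun m => p.2 m = i).card ≤ d + 1}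
  have h : Dense (⋂ p ∈ I, {X : T → Fin d → ℝ |
      (Matrix.of fun m => clone w (p.2 m) (X (p.1 m))).det ≠ 0}) :=
    dense_biInter_of_isOpen (fun p _ => isOpen_det_clone_ne_zero p.1 p.2) (Set.to_countable I)
      fun p hp => dense_det_clone_ne_zero hw hp.1 hp.2
  refine h.mono fun X hX => inGeneralPosition_of_det_ne_zero hT fun g l hg hl => ?_
  exact Set.mem_iInter₂.1 hX (g, l) ⟨hg, hl⟩

end GeneralPosition

/-! ### Local constancy of the index and of the degree. -/

section Stability

variable {ι : Type*} [Fintype ι]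

theorem linearCombination_rows (V : Matrix ι ι ℝ) (c : ι → ℝ) :
    Fintype.linearCombination ℝ (fun i => V i) c = Matrix.vecMul c V := by
  rw [Fintype.linearCombination_apply, Matrix.vecMul_eq_sum]

variable [DecidableEq ι]

/-- The coefficients of `-p` in the basis consisting of the rows of `V`. -/
noncomputable def negCoeff (p : ι → ℝ) (V : Matrix ι ι ℝ) (m : ι) : ℝ :=
  -Matrix.vecMul p V.adjugate m / V.det

theorem add_linearCombination_eq_zero_iff {p : ι → ℝ} {V : Matrix ι ι ℝ} (hV : V.det ≠ 0)
    {c : ι → ℝ} : p + Fintype.linearCombination ℝ (fun i => V i) c = 0 ↔ c = negCoeff p V := by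
  have hneg : negCoeff p V = -(V.det)⁻¹ • Matrix.vecMul p V.adjugate := by
    ext m
    simp only [negCoeff, Pi.smul_apply, smul_eq_mul]
    field_simp
  rw [linearCombination_rows, hneg]
  constructor
  · intro h
    rw [eq_neg_of_add_eq_zero_left h, Matrix.neg_vecMul, Matrix.vecMul_vecMul,
      Matrix.mul_adjugate, Matrix.vecMul_smul, Matrix.vecMul_one]
    rw [neg_smul, smul_neg, neg_neg, smul_smul, inv_mul_cancel₀ hV, one_smul]
  · rintro rfl
    rw [Matrix.smul_vecMul, Matrix.vecMul_vecMul, Matrix.adjugate_mul, Matrix.vecMul_smul,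
      Matrix.vecMul_one, neg_smul, smul_smul, inv_mul_cancel₀ hV, one_smul, add_neg_cancel]

theorem posDependent_cons_iff {p : ι → ℝ} {V : Matrix ι ι ℝ} (hV : V.det ≠ 0) :
    PosDependent (cons p fun i => V i) ↔ 0 ≤ negCoeff p V := by
  constructor
  · rintro ⟨c, hc, hc0, hrel⟩
    rw [linearCombination_cons] at hrel
    have ht : c none ≠ 0 := by
      intro ht
      rw [ht, zero_smul, zero_add, linearCombination_rows] at hrel
      apply hV
      refine Matrix.exists_vecMul_eq_zero_iff.1 ⟨_, fun h => hc0 ?_, hrel⟩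
      ext o
      cases o with
      | none => exact ht
      | some m => exact congrFun h m
    have htpos : 0 < c none := lt_of_le_of_ne (hc none) ht.symm
    have h : p + Fintype.linearCombination ℝ (fun i => V i) ((c none)⁻¹ • fun m => c (some m)) =
        0 := by
      rw [map_smul, ← smul_right_injective _ ht |>.eq_iff, smul_add, smul_smul,
        mul_inv_cancel₀ ht, one_smul, smul_zero, hrel]
    rw [← (add_linearCombination_eq_zero_iff hV).1 h]
    exact smul_nonneg (inv_nonneg.2 htpos.le) fun m => hc (some m)
  · intro h
    refine ⟨fun o => o.elim 1 (negCoeff p V), fun o => ?_, fun h0 => ?_, ?_⟩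
    · cases o with
      | none => exact zero_le_one
      | some m => exact h m
    · exact one_ne_zero (congrFun h0 none)
    · rw [linearCombination_cons]
      simpa using (add_linearCombination_eq_zero_iff hV).2 rfl

/-- The coefficients of -p in the row basis depend continuously on (p, V) by Cramer's rule. They are
either all strictly positive or include a negative one, and both alternatives are open; so is the
sign of a nonzero determinant. -/
theorem eventually_index_eq {p : ι → ℝ} {V : Matrix ι ι ℝ} (hV : V.det ≠ 0)
    (h : ∀ c : ι → ℝ, 0 ≤ c → p + Fintype.linearCombination ℝ (fun i => V i) c = 0 →
      ∀ m, c m ≠ 0) :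
    ∀ᶠ q : (ι → ℝ) × Matrix ι ι ℝ in nhds (p, V), index q.1 q.2 = index p V := by
  have hdet : Continuous fun q : (ι → ℝ) × Matrix ι ι ℝ => q.2.det :=
    continuous_snd.matrix_det
  have hne : ∀ᶠ q : (ι → ℝ) × Matrix ι ι ℝ in nhds (p, V), q.2.det ≠ 0 :=
    hdet.continuousAt.eventually_ne hV
  have hsign : ∀ᶠ q : (ι → ℝ) × Matrix ι ι ℝ in nhds (p, V),
      SignType.sign q.2.det = SignType.sign V.det := by
    rcases lt_or_gt_of_ne hV with h0 | h0
    · filter_upwards [hdet.continuousAt.eventually (gt_mem_nhds h0)] with q hq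
      rw [sign_neg hq, sign_neg h0]
    · filter_upwards [hdet.continuousAt.eventually (lt_mem_nhds h0)] with q hq
      rw [sign_pos hq, sign_pos h0]
  have hcoeff : ∀ m, ContinuousAt (fun q : (ι → ℝ) × Matrix ι ι ℝ => negCoeff q.1 q.2 m)
      (p, V) := by
    intro m
    refine ContinuousAt.div ?_ hdet.continuousAt hV
    have : Continuous fun q : (ι → ℝ) × Matrix ι ι ℝ => Matrix.vecMul q.1 q.2.adjugate :=
      continuous_fst.matrix_vecMul continuous_snd.matrix_adjugate
    exact ((continuous_apply m).comp this).neg.continuousAt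
  have hdep : ∀ᶠ q : (ι → ℝ) × Matrix ι ι ℝ in nhds (p, V),
      (0 ≤ negCoeff q.1 q.2 ↔ 0 ≤ negCoeff p V) := by
    by_cases h0 : 0 ≤ negCoeff p V
    · have hpos : ∀ m, 0 < negCoeff p V m := fun m => lt_of_le_of_ne (h0 m)
        (h _ h0 ((add_linearCombination_eq_zero_iff hV).2 rfl) m).symm
      have : ∀ᶠ q : (ι → ℝ) × Matrix ι ι ℝ in nhds (p, V), ∀ m, 0 < negCoeff q.1 q.2 m :=
        Filter.eventually_all.2 fun m => (hcoeff m).eventually (lt_mem_nhds (hpos m))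
      filter_upwards [this] with q hq
      exact iff_of_true (fun m => (hq m).le) h0
    · have : ∃ m, negCoeff p V m < 0 := by
        by_contra! hcon
        exact h0 hcon
      obtain ⟨m, hm⟩ := this
      filter_upwards [(hcoeff m).eventually (gt_mem_nhds hm)] with q hq
      exact iff_of_false (fun h => (h m).not_gt hq) h0
  filter_upwards [hne, hsign, hdep] with q h1 h2 h3
  have h4 := (posDependent_cons_iff h1).trans (h3.trans (posDependent_cons_iff hV).symm)
  by_cases h5 : PosDependent (cons p fun i => V i)
  · rw [index, index, if_pos h5, if_pos (h4.2 h5), h2]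
  · rw [index, index, if_neg h5, if_neg (h4.not.2 h5)]

variable {d n : ℕ} {w : Affine.Simplex ℝ (EuclideanSpace ℝ (Fin n)) n}

theorem eventually_rookDegree_eq {z : Fin d → ℝ} {x : Fin (d + 1) × Fin n → Fin d → ℝ}
    (hdet : ∀ π, (rookMatrix w x π).det ≠ 0)
    (h : ∀ π, ∀ c : Fin (d + 1) × Fin n → ℝ, 0 ≤ c → clone w (Fin.last n) z +
      Fintype.linearCombination ℝ (fun m => rookMatrix w x π m) c = 0 → ∀ m, c m ≠ 0) :
    ∀ᶠ q : (Fin d → ℝ) × (Fin (d + 1) × Fin n → Fin d → ℝ) in nhds (z, x),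
      rookDegree w q.1 q.2 = rookDegree w z x := by
  have key : ∀ π, ∀ᶠ q : (Fin d → ℝ) × (Fin (d + 1) × Fin n → Fin d → ℝ) in nhds (z, x),
      index (clone w (Fin.last n) q.1) (rookMatrix w q.2 π) =
        index (clone w (Fin.last n) z) (rookMatrix w x π) := by
    intro π
    have h1 : Filter.Tendsto (fun q : (Fin d → ℝ) × (Fin (d + 1) × Fin n → Fin d → ℝ) =>
        rookMatrix w q.2 π) (nhds (z, x)) (nhds (rookMatrix w x π)) := by
      have : Continuous fun q : (Fin d → ℝ) × (Fin (d + 1) × Fin n → Fin d → ℝ) =>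
          rookMatrix w q.2 π := continuous_pi fun m =>
        (continuous_clone _).comp ((continuous_apply m).comp continuous_snd)
      exact this.tendsto (z, x)
    have h2 : Filter.Tendsto (fun q : (Fin d → ℝ) × (Fin (d + 1) × Fin n → Fin d → ℝ) =>
        clone w (Fin.last n) q.1) (nhds (z, x)) (nhds (clone w (Fin.last n) z)) :=
      ((continuous_clone (Fin.last n)).comp continuous_fst).tendsto (z, x)
    have h3 := (h2.prodMk_nhds h1).eventually (eventually_index_eq (hdet π) (h π))
    exact h3
  filter_upwards [Filter.eventually_all.2 key] with q hq
  simp only [rookDegree, hq]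

end Stability

/-! ### Moving one configuration into another, point by point. -/

section Deformation

variable {d n : ℕ} {w : Affine.Simplex ℝ (EuclideanSpace ℝ (Fin n)) n}
  {T : Type*} [Fintype T]

/-- Among N + 2 distinct indices, two vanishing coefficients leave a support of at most N. -/
theorem InGeneralPosition.ridgeFree {X : T → Fin d → ℝ} (hX : InGeneralPosition w X)
    {f : Option (Option (Fin (d + 1) × Fin n)) → T} (hf : Function.Injective f)
    (l : Option (Option (Fin (d + 1) × Fin n)) → Fin (n + 1)) :
    RidgeFree fun o => clone w (l o) (X (f o)) := by
  classical
  intro a b hab c hc hrel ha hb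
  obtain ⟨b', hb', hb0⟩ : ∃ b' : T → ℝ, (∀ o, b' (f o) = c o) ∧ ∀ t ∉ Set.range f, b' t = 0 :=
    ⟨Function.extend f c fun _ => 0, fun o => hf.extend_apply c _ o, fun t ht =>
      Function.extend_apply' c _ t fun ⟨o, ho⟩ => ht ⟨o, ho⟩⟩
  obtain ⟨l', hl'⟩ : ∃ l' : T → Fin (n + 1), ∀ o, l' (f o) = l o :=
    ⟨Function.extend f l fun _ => 0, fun o => hf.extend_apply l _ o⟩
  have hnn : 0 ≤ b' := by
    intro t
    by_cases ht : t ∈ Set.range f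
    · obtain ⟨o, rfl⟩ := ht
      exact (hc o).trans_eq (hb' o).symm
    · exact (hb0 t ht).ge
  have hcard : (Finset.univ.filter fun t => b' t ≠ 0).card ≤ (d + 1) * n := by
    have hsub : (Finset.univ.filter fun t => b' t ≠ 0) ⊆
        ((Finset.univ.erase a).erase b).image f := by
      intro t ht
      simp only [Finset.mem_filter, Finset.mem_univ, true_and] at ht
      have htr : t ∈ Set.range f := by
        by_contra h
        exact ht (hb0 t h)
      obtain ⟨o, rfl⟩ := htr
      rw [hb'] at ht
      refine Finset.mem_image_of_mem f ?_
      simp only [Finset.mem_erase, Finset.mem_univ, and_true]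
      exact ⟨fun h => ht (h ▸ hb), fun h => ht (h ▸ ha)⟩
    refine (Finset.card_le_card hsub).trans (Finset.card_image_le.trans ?_)
    rw [Finset.card_erase_of_mem (by simp [hab.symm]), Finset.card_erase_of_mem (by simp)]
    simp
  have hrel' : Fintype.linearCombination ℝ (fun t => clone w (l' t) (X t)) b' = 0 := by
    rw [← hrel, Fintype.linearCombination_apply, Fintype.linearCombination_apply]
    refine (Fintype.sum_of_injective f hf _ _ (fun t ht => ?_) fun o => ?_).symm
    · rw [hb0 t ht, zero_smul]
    · rw [hb', hl']
  have h := hX l' b' hnn hcard hrel'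
  ext o
  rw [← hb', h]
  rfl

/-- Two configurations of points that are jointly in general position have degrees congruent
modulo `r!`. -/
theorem rookDegree_modEq_of_inGeneralPosition (hw : ∑ i, w.points i = 0)
    {X : Option (Fin (d + 1) × Fin n) ⊕ Option (Fin (d + 1) × Fin n) → Fin d → ℝ}
    (hX : InGeneralPosition w X) :
    rookDegree w (X (.inl none)) (fun m => X (.inl (some m))) ≡
      rookDegree w (X (.inr none)) (fun m => X (.inr (some m))) [ZMOD ((n + 1)! : ℕ)] := by
  have h1 : rookDegree w (X (.inl none)) (fun m => X (.inl (some m))) =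
      rookDegree w (X (.inr none)) (fun m => X (.inl (some m))) := by
    refine rookDegree_eq_of_ridgeFree w fun π => ?_
    let f : Option (Option (Fin (d + 1) × Fin n)) →
        Option (Fin (d + 1) × Fin n) ⊕ Option (Fin (d + 1) × Fin n) :=
      fun o => o.elim (.inl none) fun o => o.elim (.inr none) fun m => .inl (some m)
    have hf : Function.Injective f := by
      rintro (_ | _ | m) (_ | _ | m') <;> simp [f]
    convert hX.ridgeFree hf (fun o => o.elim (Fin.last n) fun o => o.elim (Fin.last n) fun m =>
      π m.1 m.2.castSucc) using 1
    ext o : 1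
    rcases o with _ | _ | m <;> rfl
  rw [h1]
  -- S is the set of coloured points already moved to their new positions.
  have h2 : ∀ S : Finset (Fin (d + 1) × Fin n),
      rookDegree w (X (.inr none)) (fun m => X (.inl (some m))) ≡
        rookDegree w (X (.inr none)) (fun m => X (if m ∈ S then .inr (some m) else .inl (some m)))
          [ZMOD ((n + 1)! : ℕ)] := by
    intro S
    induction S using Finset.induction_on with
    | empty => simp [Int.ModEq.refl]
    | insert m S hm ih =>
      refine ih.trans ?_
      have hupd : (fun k => X (if k ∈ insert m S then .inr (some k) else .inl (some k))) =
          Function.update (fun k => X (if k ∈ S then .inr (some k) else .inl (some k))) m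
            (X (.inr (some m))) := by
        ext k : 1
        by_cases hk : k = m
        · simp [hk]
        · simp [hk]
      rw [hupd]
      refine rookDegree_update_modEq hw fun π => ?_
      let f : Option (Option (Fin (d + 1) × Fin n)) →
          Option (Fin (d + 1) × Fin n) ⊕ Option (Fin (d + 1) × Fin n) :=
        fun o => o.elim (.inr none) fun o => o.elim (.inr (some m)) fun k =>
          if k ∈ S then .inr (some k) else .inl (some k)
      have hf : Function.Injective f := by
        have h1 : ∀ k, (if k ∈ S then .inr (some k) else .inl (some k) :
            Option (Fin (d + 1) × Fin n) ⊕ Option (Fin (d + 1) × Fin n)) ≠ .inr none := by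
          intro k
          split_ifs <;> simp
        have h2 : ∀ k, (if k ∈ S then .inr (some k) else .inl (some k) :
            Option (Fin (d + 1) × Fin n) ⊕ Option (Fin (d + 1) × Fin n)) ≠ .inr (some m) := by
          intro k
          split_ifs with hk
          · simpa using ne_of_mem_of_not_mem hk hm
          · simp
        rintro (_ | _ | k) (_ | _ | k') h
        · rfl
        · simp [f] at h
        · exact absurd h.symm (h1 k')
        · simp [f] at h
        · rfl
        · exact absurd h.symm (h2 k')
        · exact absurd h (h1 k)
        · exact absurd h (h2 k)
        · simp only [f, Option.elim_some] at h
          split_ifs at h <;> simpa using h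
      convert hX.ridgeFree hf (fun o => o.elim (Fin.last n) fun o => o.elim (π m.1 m.2.castSucc)
        fun k => π k.1 k.2.castSucc) using 1
      ext o : 1
      rcases o with _ | _ | k <;> rfl
  simpa using h2 Finset.univ

end Deformation

/-! ### Nondegeneracy of clones. -/

section Clones

variable {d n : ℕ} {w : Affine.Simplex ℝ (EuclideanSpace ℝ (Fin n)) n}

theorem points_ne_zero (hn : 1 ≤ n) (hw : ∑ i, w.points i = 0) (i : Fin (n + 1)) :
    ∃ j, w.points i j ≠ 0 := by
  by_contra! h
  have : Nontrivial (Fin (n + 1)) := Fin.nontrivial_iff_two_le.2 (by omega)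
  obtain ⟨i', hi'⟩ := exists_ne i
  have h1 := eq_of_sum_mul_points_eq_zero hw (c := Pi.single i 1) (fun j => by
    rw [Finset.sum_eq_single i (fun b _ hb => by simp [hb]) (by simp), h, mul_zero]) i i'
  simp [hi'] at h1

theorem clone_ne_zero (hn : 1 ≤ n) (hw : ∑ i, w.points i = 0) (i : Fin (n + 1))
    (x : Fin d → ℝ) : clone w i x ≠ 0 := by
  intro h
  obtain ⟨j, hj⟩ := points_ne_zero hn hw i
  have := congrFun h (Fin.last d, j)
  simp only [clone, plus_last, one_mul] at this
  exact hj this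

theorem eq_of_clone_eq (hn : 1 ≤ n) (hw : ∑ i, w.points i = 0) {i i' : Fin (n + 1)}
    {x x' : Fin d → ℝ} (h : clone w i x = clone w i' x') : x = x' := by
  have h1 : ∀ j, w.points i j = w.points i' j := fun j => by
    simpa [clone, plus_last] using congrFun h (Fin.last d, j)
  obtain ⟨j, hj⟩ := points_ne_zero hn hw i
  ext k
  have h2 := congrFun h (k.castSucc, j)
  simp only [clone, plus_castSucc, ← h1] at h2
  exact mul_right_cancel₀ hj h2

end Clones

/-! ### Convex and affine hulls in terms of linear relations. -/

section Hulls

variable {κ E : Type*} [Fintype κ] [AddCommGroup E] [Module ℝ E]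

theorem mem_convexHull_range_iff {v : κ → E} {x : E} :
    x ∈ convexHull ℝ (Set.range v) ↔
      ∃ c : κ → ℝ, 0 ≤ c ∧ ∑ k, c k = 1 ∧ Fintype.linearCombination ℝ v c = x := by
  classical
  constructor
  · rw [convexHull_range_eq_exists_affineCombination]
    rintro ⟨s, c, hc, hsum, rfl⟩
    refine ⟨fun k => if k ∈ s then c k else 0, fun k => ?_, ?_, ?_⟩
    · by_cases hk : k ∈ s
      · simpa [hk] using hc k hk
      · simp [hk]
    · simpa using hsum
    · rw [Finset.affineCombination_eq_linear_combination _ _ _ hsum,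
        Fintype.linearCombination_apply]
      simp [ite_smul]
  · rintro ⟨c, hc, hsum, rfl⟩
    exact mem_convexHull_of_exists_fintype c v hc hsum (fun k => Set.mem_range_self k) rfl

theorem zero_mem_affineSpan {v : κ → E} {c : κ → ℝ} {S : Set E}
    (hS : ∀ k, c k ≠ 0 → v k ∈ S) (hsum : ∑ k, c k ≠ 0)
    (hrel : Fintype.linearCombination ℝ v c = 0) : (0 : E) ∈ affineSpan ℝ S := by
  have h1 : ∑ k, (∑ k, c k)⁻¹ * c k = 1 := by rw [← Finset.mul_sum, inv_mul_cancel₀ hsum]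
  have h2 := affineCombination_mem_affineSpan_image (s := Finset.univ) h1
    (s' := {k | c k ≠ 0}) (fun k _ hk => by
      have : c k = 0 := by simpa using hk
      rw [this, mul_zero]) v
  rw [Finset.affineCombination_eq_linear_combination _ _ _ h1] at h2
  simp only [mul_smul, ← Finset.smul_sum] at h2
  rw [Fintype.linearCombination_apply] at hrel
  rw [hrel, smul_zero] at h2
  refine affineSpan_mono ℝ ?_ h2
  rintro _ ⟨k, hk, rfl⟩
  exact hS k hk

end Hulls

end BMZ

/-! ### From rainbow partitions to rook placements. -/

namespace BMZCollection

open BMZ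

variable {d n : ℕ} (C : BMZCollection d n)

/-- The point with the number `(k, j)`. -/
def pt (m : Fin (d + 1) × Fin n) : Fin d → ℝ := C.c m.1 m.2

theorem mem_ground_iff {x : Fin d → ℝ} : x ∈ C.ground ↔ (∃ m, C.pt m = x) ∨ x = C.z := by
  simp only [ground, Finset.mem_biUnion, Finset.mem_univ, true_and]
  rw [Fin.exists_fin_succ', or_congr]
  · simp [color, pt]
  · simp [color]

theorem classIndex_eq {R : Fin (n + 1) → Finset (Fin d → ℝ)} (hR : C.IsMaximalRainbow R)
    (m : Fin (d + 1) × Fin n) : classIndex R (C.pt m) = C.rookPerm R m.1 m.2.castSucc :=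
  (C.mem_iff_classIndex hR (C.c_mem_ground m.1 m.2) _).1 (C.c_mem_rookPerm hR m.1 m.2)

theorem vertexMatrix_eq {R : Fin (n + 1) → Finset (Fin d → ℝ)} (hR : C.IsMaximalRainbow R)
    (w : Affine.Simplex ℝ (EuclideanSpace ℝ (Fin n)) n) :
    C.vertexMatrix w R = rookMatrix w C.pt (C.rookPerm R) := by
  ext m s
  exact congrFun (congrArg (fun i => clone w i (C.pt m)) (C.classIndex_eq hR m)) s

theorem pt_mem_iff {R : Fin (n + 1) → Finset (Fin d → ℝ)} (hR : C.IsMaximalRainbow R)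
    (m : Fin (d + 1) × Fin n) (i : Fin (n + 1)) :
    C.pt m ∈ R i ↔ C.rookPerm R m.1 m.2.castSucc = i := by
  rw [← C.classIndex_eq hR]
  exact C.mem_iff_classIndex hR (C.c_mem_ground m.1 m.2) i

theorem z_mem_iff {R : Fin (n + 1) → Finset (Fin d → ℝ)} (hR : R ∈ C.partitions)
    (i : Fin (n + 1)) : C.z ∈ R i ↔ i = Fin.last n := by
  obtain ⟨hR, hz⟩ := C.mem_partitions.1 hR
  constructor
  · intro h
    by_contra hne
    exact Finset.disjoint_left.1 (hR.disjoint _ _ hne) h hz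
  · rintro rfl
    exact hz

theorem mem_class_iff {R : Fin (n + 1) → Finset (Fin d → ℝ)} (hR : R ∈ C.partitions)
    (i : Fin (n + 1)) (x : Fin d → ℝ) :
    x ∈ R i ↔ (∃ m, C.rookPerm R m.1 m.2.castSucc = i ∧ C.pt m = x) ∨
      (i = Fin.last n ∧ x = C.z) := by
  have hR' := (C.mem_partitions.1 hR).1
  constructor
  · intro hx
    have hg : x ∈ C.ground := by
      rw [← hR'.cover]
      exact Finset.mem_biUnion.2 ⟨i, Finset.mem_univ i, hx⟩
    rcases C.mem_ground_iff.1 hg with ⟨m, rfl⟩ | rfl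
    · exact Or.inl ⟨m, (C.pt_mem_iff hR' m i).1 hx, rfl⟩
    · exact Or.inr ⟨(C.z_mem_iff hR i).1 hx, rfl⟩
  · rintro (⟨m, hm, rfl⟩ | ⟨hi, rfl⟩)
    · exact (C.pt_mem_iff hR' m i).2 hm
    · exact (C.z_mem_iff hR i).2 hi

theorem rookPerm_injOn : Set.InjOn C.rookPerm (C.partitions : Set (Fin (n + 1) → _)) := by
  intro R hR R' hR' h
  ext i x
  rw [C.mem_class_iff hR, C.mem_class_iff hR', h]

open Classical in
/-- The maximal rainbow partition given by a tuple of permutations. -/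
noncomputable def partitionOf (π : Fin (d + 1) → Equiv.Perm (Fin (n + 1))) (i : Fin (n + 1)) :
    Finset (Fin d → ℝ) :=
  (Finset.univ.filter fun m : Fin (d + 1) × Fin n => π m.1 m.2.castSucc = i).image C.pt ∪
    if i = Fin.last n then {C.z} else ∅

theorem mem_partitionOf {π : Fin (d + 1) → Equiv.Perm (Fin (n + 1))} {i : Fin (n + 1)}
    {x : Fin d → ℝ} : x ∈ C.partitionOf π i ↔
      (∃ m, π m.1 m.2.castSucc = i ∧ C.pt m = x) ∨ (i = Fin.last n ∧ x = C.z) := by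
  rw [partitionOf, Finset.mem_union, Finset.mem_image]
  refine or_congr (by simp) ?_
  split_ifs with h <;> simp [h]

theorem partitionOf_mem (π : Fin (d + 1) → Equiv.Perm (Fin (n + 1))) :
    C.partitionOf π ∈ C.partitions := by
  have hz : ∀ m, C.pt m ≠ C.z := fun m => C.c_ne_z m.1 m.2
  have hinj : Function.Injective C.pt := C.c_injective
  refine C.mem_partitions.2 ⟨⟨fun i i' hne => ?_, fun i k => ?_, ?_⟩,
    C.mem_partitionOf.2 (Or.inr ⟨rfl, rfl⟩)⟩
  · rw [Finset.disjoint_left]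
    intro x hx hx'
    rcases C.mem_partitionOf.1 hx with ⟨m, rfl, rfl⟩ | ⟨rfl, rfl⟩ <;>
      rcases C.mem_partitionOf.1 hx' with ⟨m', rfl, h⟩ | ⟨rfl, h⟩
    · exact hne (by rw [hinj h])
    · exact hz m h
    · exact hz m' h
    · exact hne rfl
  · rw [Finset.card_le_one]
    intro a ha b hb
    rw [Finset.mem_inter] at ha hb
    revert ha hb
    refine Fin.lastCases ?_ (fun k => ?_) k
    · intro ha hb
      simp only [color, Fin.snoc_last, Finset.mem_singleton] at ha hb
      rw [ha.2, hb.2]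
    · intro ha hb
      simp only [color, Fin.snoc_castSucc, Finset.mem_image, Finset.mem_univ, true_and] at ha hb
      obtain ⟨ha, j, rfl⟩ := ha
      obtain ⟨hb, j', rfl⟩ := hb
      have key : ∀ j, C.c k j ∈ C.partitionOf π i → π k j.castSucc = i := by
        intro j hj
        rcases C.mem_partitionOf.1 hj with ⟨m, hm, h⟩ | ⟨-, h⟩
        · rwa [@hinj m (k, j) h] at hm
        · exact absurd h (C.c_ne_z k j)
      rw [Fin.castSucc_injective _ ((π k).injective ((key j ha).trans (key j' hb).symm))]
  · ext x
    simp only [Finset.mem_biUnion, Finset.mem_univ, true_and, mem_partitionOf, mem_ground_iff]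
    constructor
    · rintro ⟨i, ⟨m, -, h⟩ | ⟨-, h⟩⟩
      · exact Or.inl ⟨m, h⟩
      · exact Or.inr h
    · rintro (⟨m, h⟩ | h)
      · exact ⟨_, Or.inl ⟨m, rfl, h⟩⟩
      · exact ⟨_, Or.inr ⟨rfl, h⟩⟩

theorem rookPerm_partitionOf (π : Fin (d + 1) → Equiv.Perm (Fin (n + 1))) :
    C.rookPerm (C.partitionOf π) = π := by
  have hR := (C.mem_partitions.1 (C.partitionOf_mem π)).1
  ext1 k
  exact (C.existsUnique_rookPerm hR k).unique (C.c_mem_rookPerm hR k) fun j =>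
    C.mem_partitionOf.2 (Or.inl ⟨(k, j), rfl, rfl⟩)

theorem transform_remove_z {R : Fin (n + 1) → Finset (Fin d → ℝ)} (hR : R ∈ C.partitions)
    (w : Affine.Simplex ℝ (EuclideanSpace ℝ (Fin n)) n) :
    transform w (remove R C.z) = Set.range fun m => rookMatrix w C.pt (C.rookPerm R) m := by
  ext v
  simp only [transform, remove, Set.mem_iUnion, Set.mem_image, Finset.mem_coe, Finset.mem_erase,
    Set.mem_range]
  constructor
  · rintro ⟨i, x, ⟨hxz, hx⟩, rfl⟩
    rcases (C.mem_class_iff hR i x).1 hx with ⟨m, rfl, rfl⟩ | ⟨-, h⟩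
    · exact ⟨m, rfl⟩
    · exact absurd h hxz
  · rintro ⟨m, rfl⟩
    exact ⟨_, C.pt m, ⟨C.c_ne_z m.1 m.2, (C.mem_class_iff hR _ _).2 (Or.inl ⟨m, rfl, rfl⟩)⟩, rfl⟩

variable {w : Affine.Simplex ℝ (EuclideanSpace ℝ (Fin n)) n}

/-- A point -tφ_r(z) of the face is a nonnegative relation whose coefficients on the vertices of the
face sum to 1; conversely, a nonnegative relation can be normalized in this way. -/
theorem ray_inter_face_nonempty_iff (hn : 1 ≤ n) (hw : ∑ i, w.points i = 0)
    {R : Fin (n + 1) → Finset (Fin d → ℝ)} (hR : R ∈ C.partitions) :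
    (C.ray w ∩ C.face w R).Nonempty ↔ PosDependent (cons (clone w (Fin.last n) C.z)
      fun m => rookMatrix w C.pt (C.rookPerm R) m) := by
  rw [face, C.transform_remove_z hR]
  constructor
  · rintro ⟨_, ⟨t, ht, rfl⟩, hy⟩
    obtain ⟨c, hc, hsum, hrel⟩ := mem_convexHull_range_iff.1 hy
    refine ⟨fun o => o.elim t c, fun o => ?_, fun h => ?_, ?_⟩
    · cases o with
      | none => exact ht
      | some m => exact hc m
    · have : c = 0 := funext fun m => congrFun h (some m)
      simp [this] at hsum
    · rw [linearCombination_cons]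
      simp only [Option.elim_none, Option.elim_some]
      rw [hrel, add_neg_cancel]
  · rintro ⟨c, hc, hc0, hrel⟩
    rw [linearCombination_cons] at hrel
    set b : Fin (d + 1) × Fin n → ℝ := fun m => c (some m) with hb
    have hbnn : 0 ≤ b := fun m => hc (some m)
    -- If all face coefficients vanished, a nonzero multiple of φ_r(z) would be zero, which is
    -- impossible for r ≥ 2.
    have hpos : 0 < ∑ m, b m := by
      refine lt_of_le_of_ne (Finset.sum_nonneg fun m _ => hbnn m) fun h => ?_
      have hb0 : b = 0 := funext fun m =>
        (Finset.sum_eq_zero_iff_of_nonneg fun m _ => hbnn m).1 h.symm m (Finset.mem_univ m)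
      rw [hb0, map_zero, add_zero] at hrel
      rcases smul_eq_zero.1 hrel with h | h
      · refine hc0 (funext fun o => ?_)
        cases o with
        | none => exact h
        | some m => exact congrFun hb0 m
      · exact clone_ne_zero hn hw _ _ h
    refine ⟨-(((∑ m, b m)⁻¹ * c none) • clone w (Fin.last n) C.z),
      ⟨_, mul_nonneg (inv_nonneg.2 hpos.le) (hc none), rfl⟩, mem_convexHull_range_iff.2
      ⟨(∑ m, b m)⁻¹ • b, smul_nonneg (inv_nonneg.2 hpos.le) hbnn, ?_, ?_⟩⟩
    · simp only [Pi.smul_apply, smul_eq_mul]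
      rw [← Finset.mul_sum, inv_mul_cancel₀ hpos.ne']
    · rw [map_smul, eq_neg_of_add_eq_zero_right hrel, smul_neg, mul_smul]

theorem degree_eq_rookDegree (hn : 1 ≤ n) (hw : ∑ i, w.points i = 0) :
    C.degree w = rookDegree w C.z C.pt := by
  classical
  rw [degree, Finset.sum_filter, rookDegree]
  refine Finset.sum_nbij C.rookPerm (fun _ _ => Finset.mem_univ _) C.rookPerm_injOn
    (fun π _ => ⟨_, C.partitionOf_mem π, C.rookPerm_partitionOf π⟩) fun R hR => ?_
  have hR' := (C.mem_partitions.1 hR).1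
  by_cases h : PosDependent (cons (clone w (Fin.last n) C.z)
      fun m => rookMatrix w C.pt (C.rookPerm R) m)
  · rw [if_pos ((C.ray_inter_face_nonempty_iff hn hw hR).2 h), index, if_pos h, sgn, gsgn,
      C.vertexMatrix_eq hR', mul_comm]
    rfl
  · rw [if_neg ((C.ray_inter_face_nonempty_iff hn hw hR).not.2 h), index, if_neg h, mul_zero]

variable {C}

/-- A linear relation among the rows contradicts affine independence if its coefficients sum to
zero; otherwise, after normalization, it puts the origin in the affine span of Φ(R - z). -/
theorem SufficientlyGeneral.det_ne_zero (hC : C.SufficientlyGeneral w) (hn : 1 ≤ n)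
    (hw : ∑ i, w.points i = 0) (π : Fin (d + 1) → Equiv.Perm (Fin (n + 1))) :
    (rookMatrix w C.pt π).det ≠ 0 := by
  intro hdet
  obtain ⟨v, hv, hvM⟩ := Matrix.exists_vecMul_eq_zero_iff.2 hdet
  rw [← linearCombination_rows] at hvM
  have hR := C.partitionOf_mem π
  have hrange := C.transform_remove_z hR w
  rw [C.rookPerm_partitionOf] at hrange
  have hmem : ∀ m, rookMatrix w C.pt π m ∈ transform w (remove (C.partitionOf π) C.z) := fun m => by
    rw [hrange]
    exact Set.mem_range_self m
  by_cases hsum : ∑ m, v m = 0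
  · have hinj : Function.Injective fun m =>
        (⟨rookMatrix w C.pt π m, hmem m⟩ : transform w (remove (C.partitionOf π) C.z)) := by
      intro m m' h
      exact C.c_injective (eq_of_clone_eq hn hw (congrArg Subtype.val h))
    have hai := (hC.affineIndependent _ hR).comp_embedding ⟨_, hinj⟩
    rw [affineIndependent_iff] at hai
    exact hv (funext fun m => hai Finset.univ v hsum hvM m (Finset.mem_univ m))
  · exact hC.zero_notMem _ hR C.z (C.mem_ground_iff.2 (Or.inr rfl))
      (zero_mem_affineSpan (fun m _ => hmem m) hsum hvM)

/-- A vanishing coefficient at m would put the origin in the affine span of Φ(R - a) with a the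
point m: the coefficients are nonnegative and that of φ_r(z) is 1, so their sum is positive. -/
theorem SufficientlyGeneral.coeff_ne_zero (hC : C.SufficientlyGeneral w)
    (π : Fin (d + 1) → Equiv.Perm (Fin (n + 1))) {c : Fin (d + 1) × Fin n → ℝ} (hc : 0 ≤ c)
    (hrel : clone w (Fin.last n) C.z +
      Fintype.linearCombination ℝ (fun m => rookMatrix w C.pt π m) c = 0)
    (m : Fin (d + 1) × Fin n) : c m ≠ 0 := by
  intro hm
  refine hC.zero_notMem _ (C.partitionOf_mem π) (C.pt m) (C.c_mem_ground m.1 m.2)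
    (zero_mem_affineSpan (v := cons (clone w (Fin.last n) C.z) fun m => rookMatrix w C.pt π m)
      (c := fun o => o.elim 1 c) (fun o ho => ?_) ?_ ?_)
  · simp only [transform, remove, Set.mem_iUnion]
    rcases o with _ | m'
    · exact ⟨Fin.last n, C.z, Finset.mem_erase.2 ⟨(C.c_ne_z m.1 m.2).symm,
        C.mem_partitionOf.2 (Or.inr ⟨rfl, rfl⟩)⟩, rfl⟩
    · refine ⟨π m'.1 m'.2.castSucc, C.pt m', Finset.mem_erase.2 ⟨fun h => ho ?_,
        C.mem_partitionOf.2 (Or.inl ⟨m', rfl, rfl⟩)⟩, rfl⟩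
      rw [C.c_injective h]
      exact hm
  · rw [Fintype.sum_option]
    simp only [Option.elim_none, Option.elim_some]
    have : 0 ≤ ∑ m, c m := Finset.sum_nonneg fun m _ => hc m
    positivity
  · rw [linearCombination_cons]
    simpa using hrel

theorem SufficientlyGeneral.eventually_rookDegree_eq (hC : C.SufficientlyGeneral w) (hn : 1 ≤ n)
    (hw : ∑ i, w.points i = 0) :
    ∀ᶠ q : (Fin d → ℝ) × (Fin (d + 1) × Fin n → Fin d → ℝ) in nhds (C.z, C.pt),
      rookDegree w q.1 q.2 = C.degree w := by
  rw [C.degree_eq_rookDegree hn hw]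
  exact BMZ.eventually_rookDegree_eq (hC.det_ne_zero hn hw) fun π c hc hrel m =>
    hC.coeff_ne_zero π hc hrel m

end BMZCollection

theorem mainTheorem3 (d n : ℕ) (hd : 1 ≤ d) (hn : 1 ≤ n)
    (w : Affine.Simplex ℝ (EuclideanSpace ℝ (Fin n)) n) (hw : BMZ.IsCenteredRegular w)
    (C C' : BMZCollection d n)
    (hC : C.SufficientlyGeneral w) (hC' : C'.SufficientlyGeneral w) :
    C.degree w ≡ C'.degree w [ZMOD ((n + 1)! : ℕ)] := by
  let T := Option (Fin (d + 1) × Fin n) ⊕ Option (Fin (d + 1) × Fin n)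
  let X₀ : T → Fin d → ℝ :=
    Sum.elim (fun o => o.elim C.z C.pt) (fun o => o.elim C'.z C'.pt)
  have hcont : ∀ e : Option (Fin (d + 1) × Fin n) → T,
      Continuous fun X : T → Fin d → ℝ => (X (e none), fun m => X (e (some m))) := fun e => by
    fun_prop
  have h1 : ∀ᶠ X in nhds X₀, BMZ.rookDegree w (X (.inl none)) (fun m => X (.inl (some m))) =
      C.degree w :=
    ((hcont Sum.inl).tendsto X₀).eventually (hC.eventually_rookDegree_eq hn hw.center)
  have h2 : ∀ᶠ X in nhds X₀, BMZ.rookDegree w (X (.inr none)) (fun m => X (.inr (some m))) =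
      C'.degree w :=
    ((hcont Sum.inr).tendsto X₀).eventually (hC'.eventually_rookDegree_eq hn hw.center)
  have hdense : Dense {X : T → Fin d → ℝ | BMZ.InGeneralPosition w X} :=
    BMZ.dense_inGeneralPosition hw.center (by
      simp only [T, Fintype.card_sum, Fintype.card_option, Fintype.card_prod, Fintype.card_fin]
      omega)
  -- A jointly general configuration so close to both collections that neither degree has changed.
  obtain ⟨X, hX, hX1, hX2⟩ :=
    ((mem_closure_iff_frequently.1 (hdense X₀)).and_eventually (h1.and h2)).exists
  rw [← hX1, ← hX2]
  exact BMZ.rookDegree_modEq_of_inGeneralPosition hw.center hX
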